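/- Let $n \ge 1$ be an integer and let $s \in (0,1]$. There is a constant $C = C(n,s) > 0$ such that for every $d \in \mathbb{Z}$ there exists a map $f_d \in C^\infty(\mathbb{S}^n, \mathbb{S}^n)$ with $$\deg f_d = d \qquad\text{and}\qquad [f_d]_{W^{s,\frac{n}{s}}(\mathbb{S}^n)}^{\frac{n}{s}} \le C\,|d|.$$ Here $\mathbb{S}^n$ is the unit sphere of $\mathbb{R}^{n+1}$ with its surface measure. The Brouwer degree of a smooth map $f:\mathbb{S}^n\to\mathbb{S}^n$ is $\deg f = \int_{\mathbb{S}^n} f^*\omega_{\mathbb{S}^n}$, where $\omega_{\mathbb{S}^n}$ is the volume form of $\mathbb{S}^n$ normalized by $\int_{\mathbb{S}^n}\omega_{\mathbb{S}^n}=1$. For $0<s<1$ and $p \ge 1$, $$[f]_{W^{s,p}(\mathbb{S}^n)} = \left(\int_{\mathbb{S}^n}\int_{\mathbb{S}^n}\frac{|f(x)-f(y)|^p}{|x-y|^{n+sp}}\,\mathrm{d}x\,\mathrm{d}y\right)^{\frac1p},$$ and, for $s=1$, $[f]_{W^{1,p}(\mathbb{S}^n)} = \left(\int_{\mathbb{S}^n}|Df|^p\right)^{1/p}$,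 where $|Df(x)|$ is the operator norm of the differential $Df(x)$ on the tangent space. -/

import Mathlib

open MeasureTheory Metric
open scoped Manifold ContDiff ENNReal

/-- The Euclidean space `ℝ^(n+1)`. -/
abbrev AmbientSpace (n : ℕ) : Type := EuclideanSpace ℝ (Fin (n + 1))

/-- The unit sphere `S^n ⊂ ℝ^(n+1)`, with Mathlib's smooth structure. -/
abbrev UnitSphere (n : ℕ) : Type := sphere (0 : AmbientSpace n) 1

/-- The surface measure of `S^n` induced by Lebesgue measure of `ℝ^(n+1)` (not normalized). -/
noncomputable def surfaceMeasure (n : ℕ) : Measure (UnitSphere n) :=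
  (volume : Measure (AmbientSpace n)).toSphere

open scoped Classical in
/-- The extension of a map `u : S^n → ℝ^(n+1)` that is constant on open rays from the origin,
`y ↦ u (y / ‖y‖)` (with the irrelevant value `0` at the origin). -/
noncomputable def radialExtension {n : ℕ} (u : UnitSphere n → AmbientSpace n) :
    AmbientSpace n → AmbientSpace n := fun y =>
  if hy : y = 0 then 0
  else u ⟨‖y‖⁻¹ • y, by simp [norm_smul, inv_mul_cancel₀ (norm_ne_zero_iff.mpr hy)]⟩

/-- The differential of `u : S^n → ℝ^(n+1)` at `x ∈ S^n`, as a linear map of the ambient space: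
it is the tangential differential `Du(x)` on the tangent space `T_x S^n = x^⊥`, and it vanishes
on the normal line `ℝ x`. In particular its operator norm is the operator norm of
`Du(x) : T_x S^n → ℝ^(n+1)` for the round metric. -/
noncomputable def sphereDeriv {n : ℕ} (u : UnitSphere n → AmbientSpace n) (x : UnitSphere n) :
    AmbientSpace n →L[ℝ] AmbientSpace n :=
  fderiv ℝ (radialExtension u) (x : AmbientSpace n)

/-- The Jacobian of `f : S^n → S^n` at `x`, that is, the density with respect to the surface
measure of the pull-back by `f` of the Riemannian volume form
`(v_1, …, v_n) ↦ det (y, v_1, …, v_n)`, `v_i ∈ T_y S^n`, of the sphere: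
the linear map below sends `x` to `f x` and `e ∈ T_x S^n` to `Df(x) e`, so that its determinant is
`det (f x, Df(x) e_1, …, Df(x) e_n)` for each orthonormal basis `(e_i)` of `T_x S^n` with
`det (x, e_1, …, e_n) = 1`. -/
noncomputable def sphereJacobian {n : ℕ} (f : UnitSphere n → UnitSphere n) (x : UnitSphere n) : ℝ :=
  LinearMap.det
    ((sphereDeriv (fun z => (f z : AmbientSpace n)) x
      + (innerSL ℝ (x : AmbientSpace n)).smulRight (f x : AmbientSpace n) :
        AmbientSpace n →L[ℝ] AmbientSpace n) : AmbientSpace n →ₗ[ℝ] AmbientSpace n)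

/-- The Brouwer degree of a smooth map `f : S^n → S^n`, `deg f = ∫_{S^n} f^* ω`, where `ω` is the
volume form of `S^n`, normalized by `∫_{S^n} ω = 1`. -/
noncomputable def brouwerDegree {n : ℕ} (f : UnitSphere n → UnitSphere n) : ℝ :=
  (∫ x, sphereJacobian f x ∂(surfaceMeasure n)) / (surfaceMeasure n).real Set.univ

/-- The Gagliardo semi-norm
`(∫_{S^n} ∫_{S^n} |u x - u y|^p / |x - y|^(n + s p) dx dy)^(1/p)`, for `0 < s < 1`. -/
noncomputable def gagliardoSeminorm {n : ℕ} (s p : ℝ) (u : UnitSphere n → AmbientSpace n) : ℝ≥0∞ :=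
  (∫⁻ x, ∫⁻ y,
      ENNReal.ofReal (‖u x - u y‖ ^ p / ‖(x : AmbientSpace n) - (y : AmbientSpace n)‖ ^ (n + s * p))
      ∂(surfaceMeasure n) ∂(surfaceMeasure n)) ^ (1 / p)

/-- The first order semi-norm `‖Du‖_{L^p(S^n)}` of a smooth map `u`. -/
noncomputable def dirichletSeminorm {n : ℕ} (p : ℝ) (u : UnitSphere n → AmbientSpace n) : ℝ≥0∞ :=
  (∫⁻ x, ENNReal.ofReal (‖sphereDeriv u x‖ ^ p) ∂(surfaceMeasure n)) ^ (1 / p)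

open scoped Classical in
/-- The semi-norm `[u]_{W^{s,p}(S^n)}` of a smooth map `u`, for `0 < s ≤ 1`: the Gagliardo
semi-norm for `s < 1` and `‖Du‖_{L^p}` for `s = 1`. -/
noncomputable def sobolevSeminorm {n : ℕ} (s p : ℝ) (u : UnitSphere n → AmbientSpace n) : ℝ≥0∞ :=
  if s = 1 then dirichletSeminorm p u else gagliardoSeminorm s p u

/-! At the critical exponent `p = n / s`, an `L`-Lipschitz self-map of the sphere has energy at most
`C * L ^ n`. It therefore suffices to find, for each `d`, a smooth map of degree `d` whose Lipschitz
constant is of order `|d| ^ (1 / n)` (`exists_lipschitz_map_of_degree`,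
`exists_sobolevSeminorm_rpow_le`).

The sphere has room for `|d|` disjoint caps of size about `|d| ^ (-1 / n)`. Each cap carries a
rescaled copy of one fixed bubble, which covers the sphere minus the point `-e` exactly once, and
the map equals `-e` elsewhere. Scaling costs a factor `k ~ |d| ^ (1 / n)` in the Lipschitz constant,
and disjointness prevents the bubbles from adding up. A reflection of the target handles `d < 0`.

The degree is computed in the ambient space. For a `0`-homogeneous extension `Φ`, polar coordinates
turn the degree into the average over the unit ball of the Jacobian determinant of `‖y‖ • Φ y`. On
each cone this map preserves norms, is injective with nonnegative Jacobian and fills the ball up to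
a null set, so the change of variables formula yields exactly `1` per bubble.

For `s < 1` the Gagliardo kernel is `|x - y| ^ (-2 n)`. The inner integral is split at distance `1 /
L`: nearby the Lipschitz bound gives a convergent sum because `n / s > n`, and far away boundedness
of the map is enough. -/

/-! ### The model bubble on the hyperplane orthogonal to `e` -/

section Bubble

variable {V : Type*} [NormedAddCommGroup V]

/-- A smooth radial cutoff, positive exactly on the open unit ball. -/
noncomputable def bubbleHeight (z : V) : ℝ := expNegInvGlue (1 - ‖z‖ ^ 2)

theorem bubbleHeight_nonneg (z : V) : 0 ≤ bubbleHeight z := expNegInvGlue.nonneg _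

theorem bubbleHeight_eq_zero {z : V} (hz : 1 ≤ ‖z‖) : bubbleHeight z = 0 :=
  expNegInvGlue.zero_of_nonpos (by nlinarith)

theorem bubbleHeight_pos {z : V} (hz : ‖z‖ < 1) : 0 < bubbleHeight z :=
  expNegInvGlue.pos_of_pos (by nlinarith [norm_nonneg z])

theorem bubbleHeight_le_of_norm_le {z w : V} (h : ‖z‖ ≤ ‖w‖) : bubbleHeight w ≤ bubbleHeight z :=
  expNegInvGlue.monotone (by gcongr)

/-- The height is positive near the origin, where `‖z‖` may vanish. This makes `bubble` smooth on
the whole space, centre included. -/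
theorem bubbleHeight_denom_pos (z : V) : 0 < ‖z‖ ^ 2 + bubbleHeight z ^ 2 := by
  rcases lt_or_ge ‖z‖ 1 with h | h
  · have := bubbleHeight_pos h
    positivity
  · have := sq_nonneg (bubbleHeight z)
    nlinarith

variable [InnerProductSpace ℝ V]

/-- For `z ⟂ e` and `‖e‖ = 1`, the point `bubble e z - e` of the unit sphere is the inverse
stereographic projection of `z / bubbleHeight z`. It is defined for all `z`, and vanishes off the
unit ball. -/
noncomputable def bubble (e z : V) : V :=
  (2 * bubbleHeight z / (‖z‖ ^ 2 + bubbleHeight z ^ 2)) • (z + bubbleHeight z • e)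

theorem expNegInvGlue_le_one (x : ℝ) : expNegInvGlue x ≤ 1 := by
  unfold expNegInvGlue
  split_ifs with h
  · exact zero_le_one
  · push Not at h
    exact Real.exp_le_one_iff.2 (by simpa using h.le)

theorem contDiff_bubbleHeight : ContDiff ℝ ∞ (bubbleHeight : V → ℝ) :=
  expNegInvGlue.contDiff.comp (contDiff_const.sub (contDiff_norm_sq ℝ))

theorem contDiff_bubble (e : V) : ContDiff ℝ ∞ (bubble e) := by
  have h := contDiff_bubbleHeight (V := V)
  exact ((contDiff_const.mul h).div ((contDiff_norm_sq ℝ).add (h.pow 2))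
    fun z => (bubbleHeight_denom_pos z).ne').smul (contDiff_id.add (h.smul contDiff_const))

theorem bubble_eq_zero (e : V) {z : V} (hz : 1 ≤ ‖z‖) : bubble e z = 0 := by
  simp [bubble, bubbleHeight_eq_zero hz]

/-- A zero of the nonnegative height is a minimum, so its derivative vanishes there, and `bubble` is
the height times a smooth map. The boundary of the ball is included. -/
theorem fderiv_bubble_eq_zero (e : V) {z : V} (hz : 1 ≤ ‖z‖) : fderiv ℝ (bubble e) z = 0 := by
  have h0 := bubbleHeight_eq_zero hz
  have hd : HasFDerivAt (bubbleHeight : V → ℝ) (0 : V →L[ℝ] ℝ) z := by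
    have h1 := ((contDiff_bubbleHeight (V := V)).differentiable (by simp) z).hasFDerivAt
    have h2 : IsLocalMin (bubbleHeight : V → ℝ) z :=
      Filter.Eventually.of_forall fun w => h0 ▸ bubbleHeight_nonneg w
    rwa [h2.fderiv_eq_zero] at h1
  have h1 : ContDiff ℝ ∞
      (fun z : V => (2 / (‖z‖ ^ 2 + bubbleHeight z ^ 2)) • (z + bubbleHeight z • e)) := by
    have h := contDiff_bubbleHeight (V := V)
    exact (contDiff_const.div ((contDiff_norm_sq ℝ).add (h.pow 2))
      fun z => (bubbleHeight_denom_pos z).ne').smul (contDiff_id.add (h.smul contDiff_const))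
  have h2 := hd.smul (h1.differentiable (by simp) z).hasFDerivAt
  have h3 : bubble e = fun z : V => bubbleHeight z •
      ((2 / (‖z‖ ^ 2 + bubbleHeight z ^ 2)) • (z + bubbleHeight z • e)) := by
    funext w
    rw [bubble, smul_smul]
    congr 1
    ring
  rw [h3]
  refine (h2.congr_fderiv ?_).fderiv
  ext v
  simp [h0]

theorem exists_lipschitzWith_bubble [FiniteDimensional ℝ V] (e : V) :
    ∃ K : NNReal, LipschitzWith K (bubble e) := by
  refine ContDiff.lipschitzWith_of_hasCompactSupport (𝕂 := ℝ) (n := ∞) ?_ (contDiff_bubble e)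
    (by simp)
  refine HasCompactSupport.intro (isCompact_closedBall (0 : V) 1) fun z hz => bubble_eq_zero e ?_
  simp only [mem_closedBall, dist_zero_right, not_le] at hz
  exact hz.le

variable {e : V} (he : ‖e‖ = 1)
include he

theorem inner_bubble {z : V} (hz : inner ℝ z e = 0) :
    inner ℝ (bubble e z) e = 2 * bubbleHeight z ^ 2 / (‖z‖ ^ 2 + bubbleHeight z ^ 2) := by
  simp only [bubble, inner_smul_left, inner_add_left, hz, real_inner_self_eq_norm_sq, he,
    RCLike.conj_to_real]
  ring

theorem norm_sq_add_bubbleHeight_smul {z : V} (hz : inner ℝ z e = 0) (a : ℝ) :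
    ‖z + a • e‖ ^ 2 = ‖z‖ ^ 2 + a ^ 2 := by
  rw [norm_add_sq_real, inner_smul_right, hz, norm_smul, he]
  simp

theorem norm_bubble_sub {z : V} (hz : inner ℝ z e = 0) : ‖bubble e z - e‖ = 1 := by
  have h : ‖bubble e z - e‖ ^ 2 = 1 := by
    rw [norm_sub_sq_real, inner_bubble he hz, bubble, norm_smul, mul_pow,
      norm_sq_add_bubbleHeight_smul he hz, he, Real.norm_eq_abs, sq_abs]
    have := (bubbleHeight_denom_pos z).ne'
    field_simp
    ring
  nlinarith [norm_nonneg (bubble e z - e)]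

/-- Normalizing the component along `e` recovers `z / bubbleHeight z`. This determines `z`, because
the height decreases as the norm grows. -/
theorem bubble_injOn {z w : V} (hz : inner ℝ z e = 0) (hw : inner ℝ w e = 0)
    (hz1 : ‖z‖ < 1) (hw1 : ‖w‖ < 1) (h : bubble e z = bubble e w) : z = w := by
  have key : ∀ {z : V}, inner ℝ z e = 0 → ‖z‖ < 1 →
      (inner ℝ (bubble e z) e)⁻¹ • bubble e z = (bubbleHeight z)⁻¹ • z + e := by
    intro z hz hz1
    have h0 := (bubbleHeight_pos hz1).ne'
    have h1 := (bubbleHeight_denom_pos z).ne'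
    have h2 : (2 * bubbleHeight z ^ 2 / (‖z‖ ^ 2 + bubbleHeight z ^ 2))⁻¹ *
        (2 * bubbleHeight z / (‖z‖ ^ 2 + bubbleHeight z ^ 2)) = (bubbleHeight z)⁻¹ := by
      field_simp
    rw [inner_bubble he hz, bubble, smul_smul, h2, smul_add, smul_smul, inv_mul_cancel₀ h0,
      one_smul]
  have h1 : (bubbleHeight z)⁻¹ • z = (bubbleHeight w)⁻¹ • w := by
    have := key hz hz1
    rw [h, key hw hw1] at this
    exact (add_right_cancel this).symm
  have pz := bubbleHeight_pos hz1
  have pw := bubbleHeight_pos hw1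
  have h2 : ‖z‖ * bubbleHeight w = ‖w‖ * bubbleHeight z := by
    have := congrArg norm h1
    simp only [norm_smul, norm_inv, Real.norm_of_nonneg pz.le, Real.norm_of_nonneg pw.le] at this
    field_simp at this
    linarith
  have h3 : ‖z‖ = ‖w‖ := by
    rcases le_total ‖z‖ ‖w‖ with h | h
    · have := bubbleHeight_le_of_norm_le h
      nlinarith [norm_nonneg z, norm_nonneg w]
    · have := bubbleHeight_le_of_norm_le h
      nlinarith [norm_nonneg z, norm_nonneg w]
  have h4 : bubbleHeight z = bubbleHeight w := by simp [bubbleHeight, h3]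
  rw [h4] at h1
  exact smul_right_injective _ (inv_ne_zero pw.ne') h1

/-- The stereographic projection `Z` of `v` from `-e` must equal `z / bubbleHeight z`. Hence `z = ρ
• Z`, where `ρ` is a fixed point of `ρ ↦ bubbleHeight (ρ • Z)`, found by the intermediate value
theorem. -/
theorem exists_bubble_sub_eq {v : V} (hv : ‖v‖ = 1) (hve : v ≠ -e) :
    ∃ z : V, inner ℝ z e = 0 ∧ ‖z‖ < 1 ∧ bubble e z - e = v := by
  have ha : 0 < 1 + inner ℝ v e := by
    have h1 : 0 < ‖v + e‖ ^ 2 := by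
      have : v + e ≠ 0 := fun h => hve (eq_neg_of_add_eq_zero_left h)
      positivity
    rw [norm_add_sq_real, hv, he] at h1
    linarith
  set a := 1 + inner ℝ v e with ha'
  set Z := a⁻¹ • (v + e) - e with hZ
  have hZe : inner ℝ Z e = 0 := by
    simp only [hZ, inner_sub_left, inner_smul_left, inner_add_left, real_inner_self_eq_norm_sq, he,
      RCLike.conj_to_real]
    field_simp
    simp [ha']
    ring
  have hZn : ‖Z‖ ^ 2 + 1 = 2 / a := by
    have h1 : Z + (1 : ℝ) • e = a⁻¹ • (v + e) := by simp [hZ]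
    have h2 := norm_sq_add_bubbleHeight_smul he hZe 1
    rw [h1, norm_smul, mul_pow, norm_add_sq_real, hv, he, norm_inv, Real.norm_of_nonneg ha.le] at h2
    have h3 : inner ℝ v e = a - 1 := by simp [ha']
    rw [h3] at h2
    have h4 : a * (2 - a * (‖Z‖ ^ 2 + 1)) = 0 := by
      field_simp at h2
      linarith
    rw [eq_div_iff ha.ne']
    rcases mul_eq_zero.1 h4 with h | h
    · exact absurd h ha.ne'
    · linarith
  obtain ⟨ρ, hρ, hρ0⟩ : ∃ ρ ∈ Set.Icc (0 : ℝ) 1, ρ - bubbleHeight (ρ • Z) = 0 := by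
    have hc : ContinuousOn (fun ρ : ℝ => ρ - bubbleHeight (ρ • Z)) (Set.Icc 0 1) := by
      have := (contDiff_bubbleHeight (V := V)).continuous
      fun_prop
    refine intermediate_value_Icc zero_le_one hc ⟨?_, ?_⟩
    · simpa using bubbleHeight_nonneg _
    · simpa [bubbleHeight] using expNegInvGlue_le_one (1 - ‖Z‖ ^ 2)
  have hρ1 : bubbleHeight (ρ • Z) = ρ := by linarith
  have hz1 : ‖ρ • Z‖ < 1 := by
    by_contra hcon
    push Not at hcon
    rw [bubbleHeight_eq_zero hcon] at hρ1
    simp [← hρ1] at hcon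
    linarith
  have hρpos : 0 < ρ := hρ1 ▸ bubbleHeight_pos hz1
  refine ⟨ρ • Z, by simp [inner_smul_left, hZe], hz1, ?_⟩
  have h1 : ‖Z‖ ^ 2 + 1 ≠ 0 := by positivity
  have h2 : 2 * ρ / (‖ρ • Z‖ ^ 2 + ρ ^ 2) * ρ = a := by
    rw [norm_smul, mul_pow, Real.norm_of_nonneg hρpos.le,
      show ρ ^ 2 * ‖Z‖ ^ 2 + ρ ^ 2 = ρ ^ 2 * (‖Z‖ ^ 2 + 1) by ring, hZn]
    field_simp
  rw [bubble, hρ1, ← smul_add, smul_smul, h2, hZ, sub_add_cancel, smul_smul, mul_inv_cancel₀ ha.ne',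
    one_smul, add_sub_cancel_right]

end Bubble

/-! ### Sign of the Jacobian of a bubble extended to a cone -/

section Determinant

variable {V : Type*} [NormedAddCommGroup V] [InnerProductSpace ℝ V]

theorem ContinuousLinearMap.det_id_add_smulRight [FiniteDimensional ℝ V] (φ : V →L[ℝ] ℝ) (v : V) :
    (ContinuousLinearMap.id ℝ V + φ.smulRight v).det = 1 + φ v :=
  LinearMap.transvection.det (φ : V →ₗ[ℝ] ℝ) v

theorem ContinuousLinearMap.det_comp (A B : V →L[ℝ] V) : (A.comp B).det = A.det * B.det :=
  LinearMap.det_comp _ _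

theorem ContinuousLinearMap.det_const_smul (a : ℝ) (A : V →L[ℝ] V) :
    (a • A).det = a ^ Module.finrank ℝ V * A.det :=
  LinearMap.det_smul a _

/-- Along the segment from the identity to `T` the quadratic form stays positive, so no kernel
appears and the determinant keeps the sign it has at the identity. -/
theorem ContinuousLinearMap.det_pos_of_inner_pos [FiniteDimensional ℝ V] (T : V →L[ℝ] V)
    (h : ∀ v, v ≠ 0 → 0 < inner ℝ (T v) v) : 0 < T.det := by
  by_contra hcon
  push Not at hcon
  have hc : ContinuousOn
      (fun s : ℝ => ((1 - s) • ContinuousLinearMap.id ℝ V + s • T).det) (Set.Icc 0 1) := by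
    have h1 : Continuous fun s : ℝ => (1 - s) • ContinuousLinearMap.id ℝ V + s • T := by fun_prop
    exact (ContinuousLinearMap.continuous_det.comp h1).continuousOn
  obtain ⟨s, ⟨hs0, hs1⟩, hs⟩ := intermediate_value_Icc' zero_le_one hc
    (show (0 : ℝ) ∈ Set.Icc _ _ from ⟨by simpa using hcon, by simp [ContinuousLinearMap.det]⟩)
  obtain ⟨v, hv, hv0⟩ := Submodule.exists_mem_ne_zero_of_ne_bot
    (LinearMap.bot_lt_ker_of_det_eq_zero hs).ne'
  have h1 : (1 - s) • v + s • T v = 0 := by simpa using hv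
  have h2 : (1 - s) * ‖v‖ ^ 2 + s * inner ℝ (T v) v = 0 := by
    have := congrArg (fun w => inner ℝ w v) h1
    simpa [inner_add_left, inner_smul_left, real_inner_self_eq_norm_sq] using this
  have h3 := h v hv0
  have h4 : 0 < ‖v‖ ^ 2 := by positivity
  rcases hs0.eq_or_lt with rfl | hs0
  · linarith
  · nlinarith [mul_pos hs0 h3, mul_nonneg (sub_nonneg.2 hs1) h4.le]

variable {W : Type*} [NormedAddCommGroup W] [NormedSpace ℝ W]

/-- Euler's relation for a positively homogeneous map. -/
theorem HasFDerivAt.apply_self_of_homogeneous {G : V → W} {G' : V →L[ℝ] W} {y : V}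
    (hG : HasFDerivAt G G' y) {φ : ℝ → ℝ} {a : ℝ} (hφ : HasDerivAt φ a 1)
    (h : ∀ s : ℝ, 0 < s → G (s • y) = φ s • G y) : G' y = a • G y := by
  have h1 : HasDerivAt (fun s : ℝ => s • y) y 1 := by
    simpa using (hasDerivAt_id (1 : ℝ)).smul_const y
  have h2 : HasDerivAt (fun s : ℝ => G (s • y)) (G' y) 1 := by
    have hG' : HasFDerivAt G G' ((1 : ℝ) • y) := by simpa using hG
    exact hG'.comp_hasDerivAt (1 : ℝ) h1
  have h3 : HasDerivAt (fun s : ℝ => φ s • G y) (a • G y) 1 := hφ.smul_const _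
  refine h2.unique (h3.congr_of_eventuallyEq ?_)
  filter_upwards [lt_mem_nhds zero_lt_one] with s hs using h s hs

/-- Multiplying a `2`-homogeneous map by a positive `-1`-homogeneous factor keeps the sign of the
Jacobian determinant. -/
theorem det_smul_homogeneous_nonneg [FiniteDimensional ℝ V] {G' : V →L[ℝ] V} {l' : V →L[ℝ] ℝ}
    {g y : V} {l : ℝ} (hG : G' y = (2 : ℝ) • g) (hl : l' y = -l) (hl0 : 0 < l) (h : 0 ≤ G'.det) :
    0 ≤ (l • G' + l'.smulRight g).det := by
  -- Since `g = G' (y / 2)`, the rank-one term factors through `G'`. What remains is `l` times a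
  -- rank-one perturbation of the identity of determinant `1 - 1 / 2`.
  have h1 : l • G' + l'.smulRight g =
      G'.comp (l • (ContinuousLinearMap.id ℝ V + ((2 * l)⁻¹ • l').smulRight y)) := by
    ext v
    simp only [_root_.add_apply, _root_.smul_apply,
      ContinuousLinearMap.smulRight_apply, ContinuousLinearMap.comp_apply,
      ContinuousLinearMap.id_apply, map_smul, map_add, hG, smul_add, smul_smul, smul_eq_mul]
    congr 2
    field_simp
  rw [h1, ContinuousLinearMap.det_comp, ContinuousLinearMap.det_const_smul,
    ContinuousLinearMap.det_id_add_smulRight]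
  have h2 : 1 + ((2 * l)⁻¹ • l') y = 1 / 2 := by
    simp only [_root_.smul_apply, hl, smul_eq_mul]
    field_simp
    norm_num
  rw [h2]
  positivity

variable (e c : V) (k : ℝ)

/-- The point `z` of the hyperplane `e^⊥` that `y` is mapped to by the central projection with
centre `c` and scale `k`. -/
noncomputable def coneCoord (y : V) : V := k • ((inner ℝ y e)⁻¹ • y - c)

/-- The open round cone over the ball of centre `c` and radius `1 / k`. -/
def bubbleCone : Set V := {y | 0 < inner ℝ y e ∧ k * ‖y - inner ℝ y e • c‖ < inner ℝ y e}

/-- The `1`-homogeneous extension of the bubble supported in `bubbleCone e c k`. -/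
noncomputable def coneMap (y : V) : V := ‖y‖ • (bubble e (coneCoord e c k y) - e)

/-- The height of `bubble`, made `1`-homogeneous. -/
noncomputable def coneHeight (y : V) : ℝ := inner ℝ y e * bubbleHeight (coneCoord e c k y)

/-- The `1`-homogeneous lift whose double angle map is `coneMap`. -/
noncomputable def coneLift (y : V) : V := k • (y - inner ℝ y e • c) + coneHeight e c k y • e

/-- Twice the reflection at the line of `p` of the vector `e`, scaled by `‖p‖ ^ 2`. -/
noncomputable def doubleAngle (p : V) : V := (2 * inner ℝ p e) • p - ‖p‖ ^ 2 • e

variable {e c k}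

theorem isOpen_bubbleCone : IsOpen (bubbleCone e c k) := by
  have h : Continuous fun y : V => inner ℝ y e := by fun_prop
  exact (isOpen_lt continuous_const h).and (isOpen_lt (by fun_prop) h)

theorem contDiffAt_coneCoord {y : V} (hy : inner ℝ y e ≠ 0) :
    ContDiffAt ℝ ∞ (coneCoord e c k) y := by
  unfold coneCoord
  have h : ContDiffAt ℝ ∞ (fun y : V => inner ℝ y e) y :=
    contDiffAt_id.inner ℝ contDiffAt_const
  exact contDiffAt_const.smul (((h.inv hy).smul contDiffAt_id).sub contDiffAt_const)

theorem coneCoord_smul {s : ℝ} (hs : 0 < s) (y : V) :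
    coneCoord e c k (s • y) = coneCoord e c k y := by
  simp only [coneCoord, inner_smul_left, RCLike.conj_to_real, smul_smul, mul_inv]
  congr 3
  field_simp

theorem inner_smul_coneCoord {y : V} (hy : inner ℝ y e ≠ 0) :
    inner ℝ y e • coneCoord e c k y = k • (y - inner ℝ y e • c) := by
  rw [coneCoord, smul_comm, smul_sub, smul_smul, mul_inv_cancel₀ hy, one_smul]

theorem norm_coneCoord_lt_one (hk : 0 < k) {y : V} (hy : 0 < inner ℝ y e) :
    ‖coneCoord e c k y‖ < 1 ↔ k * ‖y - inner ℝ y e • c‖ < inner ℝ y e := by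
  have h := congrArg norm (inner_smul_coneCoord (c := c) (k := k) hy.ne')
  rw [norm_smul, norm_smul, Real.norm_of_nonneg hy.le, Real.norm_of_nonneg hk.le] at h
  rw [← h]
  constructor
  · intro h1; nlinarith
  · intro h1; by_contra h2; push Not at h2; nlinarith

theorem mem_bubbleCone_iff (hk : 0 < k) {y : V} :
    y ∈ bubbleCone e c k ↔ 0 < inner ℝ y e ∧ ‖coneCoord e c k y‖ < 1 :=
  and_congr_right fun h => (norm_coneCoord_lt_one hk h).symm

variable (he : ‖e‖ = 1) (hc : inner ℝ c e = 1)
include hc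

theorem inner_coneCoord {y : V} (hy : inner ℝ y e ≠ 0) : inner ℝ (coneCoord e c k y) e = 0 := by
  simp [coneCoord, inner_smul_left, inner_sub_left, hc, hy]

include he

theorem inner_coneLift (y : V) : inner ℝ (coneLift e c k y) e = coneHeight e c k y := by
  simp [coneLift, inner_add_left, inner_smul_left, inner_sub_left, hc, he]

theorem norm_sq_coneLift {y : V} (hy : inner ℝ y e ≠ 0) :
    ‖coneLift e c k y‖ ^ 2 = inner ℝ y e ^ 2 *
      (‖coneCoord e c k y‖ ^ 2 + bubbleHeight (coneCoord e c k y) ^ 2) := by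
  rw [coneLift, ← inner_smul_coneCoord hy, coneHeight, ← smul_smul, ← smul_add, norm_smul, mul_pow,
    norm_sq_add_bubbleHeight_smul he (inner_coneCoord hc hy), Real.norm_eq_abs, sq_abs]

/-- Inverse stereographic projection doubles the angle to `e`. This splits the cone map into two
maps with tractable determinants, up to a positive factor. -/
theorem coneMap_eq {y : V} (hy : inner ℝ y e ≠ 0) :
    coneMap e c k y = (‖y‖ / ‖coneLift e c k y‖ ^ 2) • doubleAngle e (coneLift e c k y) := by
  have h1 := bubbleHeight_denom_pos (coneCoord e c k y)
  have h2 := norm_sq_coneLift (k := k) he hc hy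
  have h3 : 0 < ‖coneLift e c k y‖ ^ 2 := by rw [h2]; positivity
  have h4 : coneLift e c k y = inner ℝ y e •
      (coneCoord e c k y + bubbleHeight (coneCoord e c k y) • e) := by
    rw [coneLift, ← inner_smul_coneCoord hy, coneHeight, ← smul_smul, ← smul_add]
  rw [coneMap, div_eq_mul_inv, ← smul_smul]
  congr 1
  rw [doubleAngle, smul_sub, smul_smul, smul_smul, inv_mul_cancel₀ h3.ne', one_smul,
    inner_coneLift he hc, bubble]
  congr 1
  nth_rw 2 [h4]
  rw [smul_smul, h2, coneHeight]
  congr 1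
  field_simp

theorem det_fderiv_coneMap_nonneg [FiniteDimensional ℝ V] (hk : 0 < k) {y : V}
    (hy : y ∈ bubbleCone e c k) :
    DifferentiableAt ℝ (coneMap e c k) y ∧ 0 ≤ (fderiv ℝ (coneMap e c k) y).det := by
  obtain ⟨ht, hz⟩ := (mem_bubbleCone_iff hk).1 hy
  have hy0 : y ≠ 0 := by rintro rfl; simp at ht
  have hec : inner ℝ e c = 1 := by rw [real_inner_comm, hc]
  -- the height
  have hmu : HasFDerivAt (coneHeight e c k) (fderiv ℝ (coneHeight e c k) y) y := by
    refine DifferentiableAt.hasFDerivAt ?_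
    refine DifferentiableAt.mul (differentiableAt_id.inner ℝ (differentiableAt_const e)) ?_
    exact ((contDiff_bubbleHeight (V := V)).differentiable (by simp) _).comp y
      ((contDiffAt_coneCoord ht.ne').differentiableAt (by simp))
  set mu' := fderiv ℝ (coneHeight e c k) y with hmu'
  -- Moving along `c` fixes `y - inner ℝ y e • c` and increases `inner ℝ y e`. The cone coordinate
  -- shrinks, so both factors of the height grow.
  have hmuc : 0 ≤ mu' c := by
    have h1 : HasDerivAt (fun s : ℝ => y + s • c) c 0 := by
      simpa using ((hasDerivAt_id (0 : ℝ)).smul_const c).const_add y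
    have h2 : HasDerivAt (fun s : ℝ => coneHeight e c k (y + s • c)) (mu' c) 0 := by
      have h3 : HasFDerivAt (coneHeight e c k) mu' (y + (0 : ℝ) • c) := by simpa using hmu
      exact h3.comp_hasDerivAt (0 : ℝ) h1
    have h4 : MonotoneOn (fun s : ℝ => coneHeight e c k (y + s • c)) (Set.Ici 0) := by
      intro a (ha : 0 ≤ a) b (hb : 0 ≤ b) hab
      have h5 : ∀ s : ℝ, inner ℝ (y + s • c) e = inner ℝ y e + s := by
        intro s; simp [inner_add_left, inner_smul_left, hc]
      have h6 : ∀ s : ℝ, 0 ≤ s → ‖coneCoord e c k (y + s • c)‖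
          = k * ‖y - inner ℝ y e • c‖ / (inner ℝ y e + s) := by
        intro s hs
        have h7 : 0 < inner ℝ y e + s := by positivity
        have h8 := congrArg norm (inner_smul_coneCoord (e := e) (c := c) (k := k) (y := y + s • c)
          (by rw [h5]; exact h7.ne'))
        rw [h5, norm_smul, norm_smul, Real.norm_of_nonneg h7.le, Real.norm_of_nonneg hk.le,
          show y + s • c - (inner ℝ y e + s) • c = y - inner ℝ y e • c by module] at h8
        rw [← h8]
        field_simp
      simp only [coneHeight, h5]
      gcongr
      · exact bubbleHeight_nonneg _
      · apply bubbleHeight_le_of_norm_le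
        rw [h6 a ha, h6 b hb]
        gcongr
    have h9 := h4.derivWithin_nonneg (x := 0)
    rwa [h2.hasDerivWithinAt.derivWithin (uniqueDiffWithinAt_Ici 0)] at h9
  have hmupos : 0 < coneHeight e c k y := mul_pos ht (bubbleHeight_pos hz)
  -- the lift
  set p := coneLift e c k y with hp
  have hpe : 0 < inner ℝ p e := by rw [hp, inner_coneLift he hc]; exact hmupos
  have hp0 : p ≠ 0 := by intro h; simp [h] at hpe
  set A : V →L[ℝ] V := k • (ContinuousLinearMap.id ℝ V - (innerSL ℝ e).smulRight c) with hA
  have hlift : HasFDerivAt (coneLift e c k) (A + mu'.smulRight e) y := by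
    have h1 : HasFDerivAt (fun y => A y + coneHeight e c k y • e) (A + mu'.smulRight e) y :=
      A.hasFDerivAt.add (hmu.smul_const e)
    convert h1 using 1
    funext w
    simp [coneLift, hA, real_inner_comm]
  have hdetlift : 0 ≤ (A + mu'.smulRight e).det := by
    -- Two rank-one perturbations of the identity, with determinants `k⁻¹` (before scaling by `k`)
    -- and `mu' c`.
    have h1 : A + mu'.smulRight e = (k • (ContinuousLinearMap.id ℝ V +
        (innerSL ℝ e).smulRight (k⁻¹ • e - c))).comp
        (ContinuousLinearMap.id ℝ V + (mu' - innerSL ℝ e).smulRight c) := by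
      ext v
      simp [hA, hec]
      match_scalars <;> field_simp <;> ring
    rw [h1, ContinuousLinearMap.det_comp, ContinuousLinearMap.det_const_smul,
      ContinuousLinearMap.det_id_add_smulRight, ContinuousLinearMap.det_id_add_smulRight]
    have h2 : 1 + (innerSL ℝ e) (k⁻¹ • e - c) = k⁻¹ := by
      simp [inner_sub_right, inner_smul_right, he, hec]
    have h3 : 1 + (mu' - innerSL ℝ e) c = mu' c := by
      simp [hec]
    rw [h2, h3]
    positivity
  -- the double angle map
  set B : V →L[ℝ] V := (2 * inner ℝ p e) • ContinuousLinearMap.id ℝ V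
    + ((2 : ℝ) • innerSL ℝ e).smulRight p - ((2 : ℝ) • innerSL ℝ p).smulRight e with hB
  have hdouble : HasFDerivAt (doubleAngle e) B p := by
    have h1 : HasFDerivAt (fun p : V => inner ℝ p e) (innerSL ℝ e) p := by
      simpa [real_inner_comm] using (innerSL ℝ e).hasFDerivAt (x := p)
    have h2 := (h1.const_mul 2).smul (hasFDerivAt_id p)
    have h3 := (hasStrictFDerivAt_norm_sq p).hasFDerivAt.smul_const e
    refine (h2.sub h3).congr_fderiv ?_
    ext v
    simp [hB]
  have hdetdouble : 0 ≤ B.det := by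
    refine (ContinuousLinearMap.det_pos_of_inner_pos B fun v hv => ?_).le
    -- The two rank-one terms of `B` form a skew-symmetric map and drop out of the quadratic form.
    have h1 : inner ℝ (B v) v = 2 * inner ℝ p e * ‖v‖ ^ 2 := by
      simp [hB, inner_add_left, inner_sub_left, inner_smul_left]
      ring
    rw [h1]
    positivity
  have hG := hdouble.comp y hlift
  have hG2 : (B.comp (A + mu'.smulRight e)) y = (2 : ℝ) • doubleAngle e p := by
    refine hG.apply_self_of_homogeneous (φ := fun s => s ^ 2)
      (by simpa using hasDerivAt_pow 2 (1 : ℝ)) fun s hs => ?_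
    have h1 : coneLift e c k (s • y) = s • coneLift e c k y := by
      simp only [coneLift, coneHeight, coneCoord_smul hs, inner_smul_left, RCLike.conj_to_real]
      module
    simp only [Function.comp_apply, h1, doubleAngle, inner_smul_left, norm_smul, mul_pow,
      RCLike.conj_to_real, Real.norm_eq_abs, sq_abs]
    module
  -- the positive factor
  have hl : DifferentiableAt ℝ (fun y => ‖y‖ / ‖coneLift e c k y‖ ^ 2) y := by
    have h1 : DifferentiableAt ℝ (fun y => ‖y‖) y := differentiableAt_id.norm ℝ hy0
    have h2 : DifferentiableAt ℝ (fun y => ‖coneLift e c k y‖ ^ 2) y :=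
      hlift.differentiableAt.norm_sq ℝ
    simp only [div_eq_mul_inv]
    exact h1.fun_mul (h2.fun_inv (pow_ne_zero 2 (norm_ne_zero_iff.2 hp0)))
  have hl1 := hl.hasFDerivAt
  have hl2 := hl1.apply_self_of_homogeneous (φ := fun s => s⁻¹) (a := -1)
      (by simpa using hasDerivAt_inv (one_ne_zero (α := ℝ))) fun s hs => by
    have h1 : coneLift e c k (s • y) = s • coneLift e c k y := by
      simp only [coneLift, coneHeight, coneCoord_smul hs, inner_smul_left, RCLike.conj_to_real]
      module
    simp only [h1, norm_smul, mul_pow, Real.norm_of_nonneg hs.le, smul_eq_mul]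
    field_simp
  have hfin := hl1.smul hG
  have hev : coneMap e c k =ᶠ[nhds y]
      (fun y => (‖y‖ / ‖coneLift e c k y‖ ^ 2) • (doubleAngle e ∘ coneLift e c k) y) := by
    have : ∀ᶠ w in nhds y, inner ℝ w e ≠ 0 :=
      (show Continuous fun w : V => inner ℝ w e by fun_prop).continuousAt.eventually_ne ht.ne'
    filter_upwards [this] with w hw using coneMap_eq he hc hw
  have hfin2 := hfin.congr_of_eventuallyEq hev
  refine ⟨hfin2.differentiableAt, ?_⟩
  rw [hfin2.fderiv]
  refine det_smul_homogeneous_nonneg hG2 (by simpa using hl2) (by positivity) ?_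
  rw [ContinuousLinearMap.det_comp]
  positivity

end Determinant

/-! ### A single cone covers the ball once -/

section ConeMap

variable {V : Type*} [NormedAddCommGroup V] [InnerProductSpace ℝ V] {e c : V} {k : ℝ}
  (he : ‖e‖ = 1) (hc : inner ℝ c e = 1)
include he hc

theorem norm_coneMap {y : V} (hy : inner ℝ y e ≠ 0) : ‖coneMap e c k y‖ = ‖y‖ := by
  rw [coneMap, norm_smul, norm_bubble_sub he (inner_coneCoord hc hy), norm_norm, mul_one]

theorem coneMap_injOn (hk : 0 < k) : Set.InjOn (coneMap e c k) (bubbleCone e c k) := by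
  intro y hy w hw h
  obtain ⟨hy1, hy2⟩ := (mem_bubbleCone_iff hk).1 hy
  obtain ⟨hw1, hw2⟩ := (mem_bubbleCone_iff hk).1 hw
  have hn : ‖y‖ = ‖w‖ := by
    rw [← norm_coneMap (k := k) he hc hy1.ne', h, norm_coneMap he hc hw1.ne']
  have hy0 : ‖y‖ ≠ 0 := by
    rw [norm_ne_zero_iff]; rintro rfl; simp at hy1
  have h1 : coneCoord e c k y = coneCoord e c k w := by
    refine bubble_injOn he (inner_coneCoord hc hy1.ne') (inner_coneCoord hc hw1.ne') hy2 hw2 ?_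
    rw [coneMap, coneMap, ← hn] at h
    exact sub_left_injective (smul_right_injective V hy0 h)
  have h2 : (inner ℝ y e)⁻¹ • y = (inner ℝ w e)⁻¹ • w :=
    sub_left_injective (smul_right_injective V hk.ne' h1)
  have h3 : (inner ℝ y e)⁻¹ = (inner ℝ w e)⁻¹ := by
    have := congrArg norm h2
    rw [norm_smul, norm_smul, hn, Real.norm_of_nonneg (inv_nonneg.2 hy1.le),
      Real.norm_of_nonneg (inv_nonneg.2 hw1.le)] at this
    exact mul_right_cancel₀ (hn ▸ hy0) this
  rw [h3] at h2
  exact smul_right_injective V (inv_ne_zero hw1.ne') h2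

/-- Only the closed ray through `-e` is missed. Excluding the whole line loses nothing, since it is
null in dimension at least two. -/
theorem exists_coneMap_eq (hk : 0 < k) {v : V} (hv : v ∉ Submodule.span ℝ {e}) :
    ∃ y ∈ bubbleCone e c k, coneMap e c k y = v := by
  have hv0 : 0 < ‖v‖ := norm_pos_iff.2 fun h => hv (h ▸ Submodule.zero_mem _)
  obtain ⟨z, hz, hz1, hzv⟩ := exists_bubble_sub_eq he (v := ‖v‖⁻¹ • v)
    (by rw [norm_smul, norm_inv, norm_norm, inv_mul_cancel₀ hv0.ne']) fun h => hv <| by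
      rw [Submodule.mem_span_singleton]
      refine ⟨-‖v‖, ?_⟩
      rw [neg_smul, ← smul_neg, ← h, smul_smul, mul_inv_cancel₀ hv0.ne', one_smul]
  set w := k⁻¹ • z + c with hw
  have hwe : inner ℝ w e = 1 := by simp [hw, inner_add_left, inner_smul_left, hz, hc]
  have hw0 : 0 < ‖w‖ := norm_pos_iff.2 fun h => by simp [h] at hwe
  have hr : 0 < ‖v‖ / ‖w‖ := by positivity
  have hcoord : coneCoord e c k ((‖v‖ / ‖w‖) • w) = z := by
    rw [coneCoord_smul hr, coneCoord, hwe, inv_one, one_smul, hw, add_sub_cancel_right, smul_smul,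
      mul_inv_cancel₀ hk.ne', one_smul]
  refine ⟨(‖v‖ / ‖w‖) • w, (mem_bubbleCone_iff hk).2 ⟨?_, hcoord ▸ hz1⟩, ?_⟩
  · simpa [inner_smul_left, hwe] using hr
  · rw [coneMap, hcoord, hzv, norm_smul, Real.norm_of_nonneg hr.le, div_mul_cancel₀ _ hw0.ne',
      smul_smul, mul_inv_cancel₀ hv0.ne', one_smul]

variable [FiniteDimensional ℝ V] [MeasurableSpace V] [BorelSpace V] (μ : Measure V)
  [μ.IsAddHaarMeasure]

theorem coneMap_image_ae_eq (hdim : 2 ≤ Module.finrank ℝ V) (hk : 0 < k) :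
    coneMap e c k '' (bubbleCone e c k ∩ ball 0 1) =ᵐ[μ] ball (0 : V) 1 := by
  have hnull : μ (Submodule.span ℝ {e} : Set V) = 0 := by
    refine Measure.addHaar_submodule μ _ fun h => ?_
    have := finrank_span_singleton (K := ℝ) (v := e) (by rintro rfl; simp at he)
    rw [h, finrank_top] at this
    omega
  have h1 : coneMap e c k '' (bubbleCone e c k ∩ ball 0 1) ⊆ ball 0 1 := by
    rintro _ ⟨y, ⟨hy, hy1⟩, rfl⟩
    rw [mem_ball_zero_iff, norm_coneMap he hc hy.1.ne']
    simpa using hy1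
  have h2 : ball (0 : V) 1 \ Submodule.span ℝ {e} ⊆
      coneMap e c k '' (bubbleCone e c k ∩ ball 0 1) := by
    rintro v ⟨hv1, hv⟩
    obtain ⟨y, hy, rfl⟩ := exists_coneMap_eq he hc hk hv
    refine ⟨y, ⟨hy, ?_⟩, rfl⟩
    rw [mem_ball_zero_iff, norm_coneMap he hc hy.1.ne'] at hv1
    simpa using hv1
  refine h1.eventuallyLE.antisymm ?_
  refine (ae_le_set.2 (measure_mono_null (fun v hv => ?_) hnull))
  by_contra h
  exact hv.2 (h2 ⟨hv.1, h⟩)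

/-- Change of variables for the constant `1` on the image. The absolute value of the Jacobian
disappears because its sign is known. -/
theorem setIntegral_det_fderiv_coneMap (hdim : 2 ≤ Module.finrank ℝ V) (hk : 0 < k) :
    IntegrableOn (fun y => (fderiv ℝ (coneMap e c k) y).det) (bubbleCone e c k ∩ ball 0 1) μ ∧
    ∫ y in bubbleCone e c k ∩ ball 0 1, (fderiv ℝ (coneMap e c k) y).det ∂μ
      = μ.real (ball 0 1) := by
  have hmeas : MeasurableSet (bubbleCone e c k ∩ ball (0 : V) 1) :=
    (isOpen_bubbleCone.inter isOpen_ball).measurableSet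
  have hder : ∀ y ∈ bubbleCone e c k ∩ ball (0 : V) 1, HasFDerivWithinAt (coneMap e c k)
      (fderiv ℝ (coneMap e c k) y) (bubbleCone e c k ∩ ball 0 1) y := fun y hy =>
    (det_fderiv_coneMap_nonneg he hc hk hy.1).1.hasFDerivAt.hasFDerivWithinAt
  have hinj : Set.InjOn (coneMap e c k) (bubbleCone e c k ∩ ball 0 1) :=
    (coneMap_injOn he hc hk).mono Set.inter_subset_left
  have habs : Set.EqOn (fun y => |(fderiv ℝ (coneMap e c k) y).det| • (1 : ℝ))
      (fun y => (fderiv ℝ (coneMap e c k) y).det) (bubbleCone e c k ∩ ball 0 1) := fun y hy => by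
    simp [abs_of_nonneg (det_fderiv_coneMap_nonneg he hc hk hy.1).2]
  have hae := coneMap_image_ae_eq he hc μ hdim hk
  constructor
  · rw [← integrableOn_congr_fun habs hmeas,
      ← integrableOn_image_iff_integrableOn_abs_det_fderiv_smul μ hmeas hder hinj (fun _ => (1 : ℝ)),
      integrableOn_congr_set_ae hae]
    exact integrableOn_const measure_ball_lt_top.ne
  · rw [← setIntegral_congr_fun hmeas habs,
      ← integral_image_eq_integral_abs_det_fderiv_smul μ hmeas hder hinj (fun _ => (1 : ℝ)),
      setIntegral_congr_set hae]
    simp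

end ConeMap

/-! ### Gluing disjoint bubbles -/

section MultiBubble

variable {V : Type*} [NormedAddCommGroup V] [InnerProductSpace ℝ V] {ι : Type*}
  {e : V} {c : ι → V} {k : ℝ}

/-- At height `t = inner ℝ y e` the cones are balls of radius `t / k` whose centres are at least `2
t / k` apart. -/
theorem disjoint_bubbleCone (hk : 0 < k) (hsep : Pairwise fun i j => 2 ≤ k * ‖c i - c j‖) :
    Pairwise fun i j => Disjoint (bubbleCone e (c i) k) (bubbleCone e (c j) k) := by
  intro i j hij
  rw [Set.disjoint_left]
  rintro y ⟨hy, hi⟩ ⟨-, hj⟩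
  have h1 := hsep hij
  have h2 : inner ℝ y e * ‖c i - c j‖ ≤ ‖y - inner ℝ y e • c i‖ + ‖y - inner ℝ y e • c j‖ := by
    calc inner ℝ y e * ‖c i - c j‖
        = ‖(y - inner ℝ y e • c j) - (y - inner ℝ y e • c i)‖ := by
          rw [← abs_of_pos hy, ← Real.norm_eq_abs, ← norm_smul, Real.norm_of_nonneg hy.le]
          congr 1
          module
      _ ≤ _ := by rw [add_comm]; exact norm_sub_le _ _
  nlinarith [mul_le_mul_of_nonneg_left h2 hk.le]

variable [Fintype ι]

open scoped Classical in
/-- The positively `0`-homogeneous map that is a bubble in each of the cones `bubbleCone e (c i) k`,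
and constant outside of their union. -/
noncomputable def multiBubble (e : V) (c : ι → V) (k : ℝ) (y : V) : V :=
  (if 0 < inner ℝ y e then ∑ i, bubble e (coneCoord e (c i) k y) else 0) - e

theorem multiBubble_smul {s : ℝ} (hs : 0 < s) (y : V) :
    multiBubble e c k (s • y) = multiBubble e c k y := by
  simp [multiBubble, coneCoord_smul hs, inner_smul_left, hs]

theorem multiBubble_of_forall_notMem (hk : 0 < k) {y : V} (hy : ∀ i, y ∉ bubbleCone e (c i) k) :
    multiBubble e c k y = -e := by
  rw [multiBubble]
  split_ifs with h
  · rw [Finset.sum_eq_zero, zero_sub]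
    intro i _
    refine bubble_eq_zero e ?_
    by_contra hcon
    exact hy i ((mem_bubbleCone_iff hk).2 ⟨h, not_le.1 hcon⟩)
  · simp

theorem multiBubble_of_mem (hk : 0 < k) (hsep : Pairwise fun i j => 2 ≤ k * ‖c i - c j‖)
    {i : ι} {y : V} (hy : y ∈ bubbleCone e (c i) k) :
    multiBubble e c k y = bubble e (coneCoord e (c i) k y) - e := by
  rw [multiBubble, if_pos hy.1, Finset.sum_eq_single i _ (by simp)]
  intro j _ hji
  refine bubble_eq_zero e ?_
  by_contra hcon
  exact (disjoint_bubbleCone hk hsep hji).le_bot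
    ⟨(mem_bubbleCone_iff hk).2 ⟨hy.1, not_le.1 hcon⟩, hy⟩

/-- The cone inequality fails strictly at such `y`, hence also nearby. This gives smoothness across
the hyperplane, where `coneCoord` is singular. -/
theorem multiBubble_eventuallyEq (hk : 0 < k) {y : V} (hy0 : y ≠ 0) (hy : inner ℝ y e ≤ 0) :
    multiBubble e c k =ᶠ[nhds y] fun _ => -e := by
  have h : ∀ i, ∀ᶠ w in nhds y, inner ℝ w e < k * ‖w - inner ℝ w e • c i‖ := by
    intro i
    have h1 : Continuous fun w : V => inner ℝ w e := by fun_prop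
    refine h1.continuousAt.eventually_lt (by fun_prop) ?_
    rcases hy.eq_or_lt with h | h
    · have := norm_pos_iff.2 hy0
      simp only [h, zero_smul, sub_zero]
      positivity
    · exact h.trans_le (by positivity)
  filter_upwards [Filter.eventually_all.2 h] with w hw
  exact multiBubble_of_forall_notMem hk fun i hi => (hw i).not_gt hi.2

theorem multiBubble_eventuallyEq_sum {y : V} (hy : 0 < inner ℝ y e) :
    multiBubble e c k =ᶠ[nhds y] fun y => ∑ i, bubble e (coneCoord e (c i) k y) - e := by
  have h1 : Continuous fun w : V => inner ℝ w e := by fun_prop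
  filter_upwards [h1.continuousAt.eventually (lt_mem_nhds hy)] with w hw
  rw [multiBubble, if_pos hw]

theorem contDiffAt_multiBubble (hk : 0 < k) {y : V} (hy0 : y ≠ 0) :
    ContDiffAt ℝ ∞ (multiBubble e c k) y := by
  rcases lt_or_ge 0 (inner ℝ y e) with hy | hy
  · refine ContDiffAt.congr_of_eventuallyEq ?_ (multiBubble_eventuallyEq_sum hy)
    exact (ContDiffAt.sum fun i _ => (contDiff_bubble e).contDiffAt.comp y
      (contDiffAt_coneCoord hy.ne')).sub contDiffAt_const
  · exact contDiffAt_const.congr_of_eventuallyEq (multiBubble_eventuallyEq hk hy0 hy)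

theorem fderiv_multiBubble_eq_zero (hk : 0 < k) {y : V} (hy0 : y ≠ 0)
    (hy : ∀ i, y ∉ bubbleCone e (c i) k) : fderiv ℝ (multiBubble e c k) y = 0 := by
  rcases lt_or_ge 0 (inner ℝ y e) with ht | ht
  · have h1 : ∀ i, HasFDerivAt (fun y => bubble e (coneCoord e (c i) k y)) (0 : V →L[ℝ] V) y := by
      intro i
      have h2 : 1 ≤ ‖coneCoord e (c i) k y‖ := by
        by_contra hcon
        exact hy i ((mem_bubbleCone_iff hk).2 ⟨ht, not_le.1 hcon⟩)
      have h3 := ((contDiff_bubble e).differentiable (by simp) (coneCoord e (c i) k y)).hasFDerivAt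
      rw [fderiv_bubble_eq_zero e h2] at h3
      have h4 : HasFDerivAt (fun y => bubble e (coneCoord e (c i) k y)) _ y := h3.comp y
        ((contDiffAt_coneCoord (c := c i) (k := k) ht.ne').differentiableAt (by simp)).hasFDerivAt
      simpa using h4
    have h5 : HasFDerivAt (fun y => ∑ i, bubble e (coneCoord e (c i) k y) - e) (0 : V →L[ℝ] V) y := by
      simpa using (HasFDerivAt.fun_sum fun i (_ : i ∈ Finset.univ) => h1 i).sub_const e
    exact (h5.congr_of_eventuallyEq (multiBubble_eventuallyEq_sum ht)).fderiv
  · rw [(multiBubble_eventuallyEq hk hy0 ht).fderiv_eq]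
    simp

theorem norm_multiBubble (he : ‖e‖ = 1) (hc : ∀ i, inner ℝ (c i) e = 1) (hk : 0 < k)
    (hsep : Pairwise fun i j => 2 ≤ k * ‖c i - c j‖) (y : V) : ‖multiBubble e c k y‖ = 1 := by
  by_cases h : ∃ i, y ∈ bubbleCone e (c i) k
  · obtain ⟨i, hi⟩ := h
    rw [multiBubble_of_mem hk hsep hi, norm_bubble_sub he (inner_coneCoord (hc i) hi.1.ne')]
  · push Not at h
    rw [multiBubble_of_forall_notMem hk h, norm_neg, he]

variable [FiniteDimensional ℝ V] [MeasurableSpace V] [BorelSpace V] (μ : Measure V)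
  [μ.IsAddHaarMeasure]

theorem integral_det_multiBubble (he : ‖e‖ = 1) (hc : ∀ i, inner ℝ (c i) e = 1) (hk : 0 < k)
    (hsep : Pairwise fun i j => 2 ≤ k * ‖c i - c j‖) (hdim : 2 ≤ Module.finrank ℝ V) :
    ∫ y in ball 0 1, (fderiv ℝ (fun y => ‖y‖ • multiBubble e c k y) y).det ∂μ
      = Fintype.card ι * μ.real (ball 0 1) := by
  have hmeas : ∀ i, MeasurableSet (bubbleCone e (c i) k ∩ ball (0 : V) 1) := fun i =>
    (isOpen_bubbleCone.inter isOpen_ball).measurableSet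
  have heq : ∀ i, Set.EqOn (fun y => (fderiv ℝ (coneMap e (c i) k) y).det)
      (fun y => (fderiv ℝ (fun y => ‖y‖ • multiBubble e c k y) y).det)
      (bubbleCone e (c i) k ∩ ball 0 1) := by
    intro i y hy
    have : coneMap e (c i) k =ᶠ[nhds y] fun y => ‖y‖ • multiBubble e c k y := by
      filter_upwards [isOpen_bubbleCone.mem_nhds hy.1] with w hw
      rw [multiBubble_of_mem hk hsep hw, coneMap]
    simp only [this.fderiv_eq]
  have h0 : ∀ y ∈ ball (0 : V) 1 \ ⋃ i, bubbleCone e (c i) k ∩ ball 0 1, y ≠ 0 →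
      (fderiv ℝ (fun y => ‖y‖ • multiBubble e c k y) y).det = 0 := by
    rintro y ⟨hy1, hy⟩ hy0
    have hy2 : ∀ i, y ∉ bubbleCone e (c i) k := fun i hi => hy (Set.mem_iUnion.2 ⟨i, hi, hy1⟩)
    have h1 : HasFDerivAt (multiBubble e c k) (0 : V →L[ℝ] V) y := by
      rw [← fderiv_multiBubble_eq_zero hk hy0 hy2]
      exact ((contDiffAt_multiBubble hk hy0).differentiableAt (by simp)).hasFDerivAt
    have h2 : DifferentiableAt ℝ (fun y : V => ‖y‖) y := differentiableAt_id.norm ℝ hy0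
    -- Only the norm varies to first order, so the derivative has rank at most one and is singular
    -- in dimension at least two.
    rw [(h2.hasFDerivAt.fun_smul h1).fderiv]
    rw [ContinuousLinearMap.det]
    refine LinearMap.det_eq_zero_iff_ker_ne_bot.2 ?_
    intro hbot
    have h3 : Module.finrank ℝ V ≤ 1 := by
      have h4 : LinearMap.ker ((fderiv ℝ (fun y : V => ‖y‖) y) : V →ₗ[ℝ] ℝ) = ⊥ := by
        refine le_bot_iff.1 (hbot ▸ fun v hv => ?_)
        have : fderiv ℝ (fun y : V => ‖y‖) y v = 0 := hv
        simp [LinearMap.mem_ker, this]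
      simpa using LinearMap.finrank_le_finrank_of_injective (LinearMap.ker_eq_bot.1 h4)
    omega
  have h1 : ∫ y in ball 0 1, (fderiv ℝ (fun y => ‖y‖ • multiBubble e c k y) y).det ∂μ
      = ∫ y in ⋃ i, bubbleCone e (c i) k ∩ ball 0 1,
        (fderiv ℝ (fun y => ‖y‖ • multiBubble e c k y) y).det ∂μ := by
    have : Nontrivial V := Module.nontrivial_of_finrank_pos (R := ℝ) (by omega)
    refine setIntegral_eq_of_subset_of_ae_sdiff_eq_zero measurableSet_ball.nullMeasurableSet
      (Set.iUnion_subset fun i => Set.inter_subset_right) ?_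
    have h3 : ∀ᵐ y ∂μ, y ≠ 0 := by simp [ae_iff]
    filter_upwards [h3] with y hy0 hy using h0 y hy hy0
  rw [h1, integral_iUnion_fintype hmeas]
  · have h2 : ∀ i, ∫ y in bubbleCone e (c i) k ∩ ball 0 1,
        (fderiv ℝ (fun y => ‖y‖ • multiBubble e c k y) y).det ∂μ = μ.real (ball 0 1) := fun i => by
      rw [← setIntegral_congr_fun (hmeas i) (heq i)]
      exact (setIntegral_det_fderiv_coneMap he (hc i) μ hdim hk).2
    simp [h2]
  · intro i j hij
    exact (disjoint_bubbleCone hk hsep hij).mono Set.inter_subset_left Set.inter_subset_left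
  · intro i
    rw [← integrableOn_congr_fun (heq i) (hmeas i)]
    exact (setIntegral_det_fderiv_coneMap he (hc i) μ hdim hk).1

end MultiBubble

/-! ### Polar coordinates for `0`-homogeneous functions -/

section Polar

variable {V : Type*} [NormedAddCommGroup V] [NormedSpace ℝ V] [FiniteDimensional ℝ V]
  [MeasurableSpace V] [BorelSpace V] (μ : Measure V) [μ.IsAddHaarMeasure]

theorem finrank_mul_setIntegral_ball_of_homogeneous [Nontrivial V] {g : V → ℝ}
    (hg : ∀ (s : ℝ) (y : V), 0 < s → g (s • y) = g y) :
    Module.finrank ℝ V * ∫ y in ball 0 1, g y ∂μ = ∫ x : sphere (0 : V) 1, g x ∂μ.toSphere := by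
  have h1 : ∫ y in ball 0 1, g y ∂μ = ∫ p : sphere (0 : V) 1 × Set.Ioi (0 : ℝ),
      g p.1 * (Set.Iio (⟨1, Set.mem_Ioi.2 one_pos⟩ : Set.Ioi (0 : ℝ))).indicator 1 p.2
        ∂(μ.toSphere.prod (.volumeIoiPow (Module.finrank ℝ V - 1))) := by
    rw [← μ.measurePreserving_homeomorphUnitSphereProd.integral_comp
        (Homeomorph.measurableEmbedding _), ← integral_indicator measurableSet_ball,
      ← setIntegral_univ, ← setIntegral_congr_set (s := ({0}ᶜ : Set V))
        (by simp [ae_eq_univ]),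
      ← integral_subtype_comap (measurableSet_singleton _).compl]
    refine integral_congr_ae (.of_forall fun y => ?_)
    have hy : 0 < ‖(y : V)‖ := norm_pos_iff.2 y.2
    have h2 : g ((homeomorphUnitSphereProd V y).1 : V) = g y := by
      rw [homeomorphUnitSphereProd_apply_fst_coe, hg _ _ (inv_pos.2 hy)]
    have h3 : (homeomorphUnitSphereProd V y).2 ∈ Set.Iio (⟨1, Set.mem_Ioi.2 one_pos⟩ : Set.Ioi (0 : ℝ))
        ↔ (y : V) ∈ ball (0 : V) 1 := by
      rw [Set.mem_Iio, ← Subtype.coe_lt_coe, homeomorphUnitSphereProd_apply_snd_coe]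
      simp
    beta_reduce
    by_cases hb : (y : V) ∈ ball (0 : V) 1
    · rw [Set.indicator_of_mem hb, h2, Set.indicator_of_mem (h3.2 hb), Pi.one_apply, mul_one]
    · rw [Set.indicator_of_notMem hb, Set.indicator_of_notMem (mt h3.1 hb), mul_zero]
  have hpos : 0 < Module.finrank ℝ V := Module.finrank_pos
  -- The radial integral of `r ^ (dim - 1)` over `(0, 1)`.
  have h4 : (Measure.volumeIoiPow (Module.finrank ℝ V - 1)).real
      (Set.Iio (⟨1, Set.mem_Ioi.2 one_pos⟩ : Set.Ioi (0 : ℝ))) = (Module.finrank ℝ V : ℝ)⁻¹ := by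
    rw [measureReal_def, Measure.volumeIoiPow_apply_Iio, ENNReal.toReal_ofReal (by positivity)]
    simp [Nat.cast_sub (show 1 ≤ Module.finrank ℝ V from hpos)]
  rw [h1, integral_prod_mul (fun x : sphere (0 : V) 1 => g x)
    ((Set.Iio (⟨1, Set.mem_Ioi.2 one_pos⟩ : Set.Ioi (0 : ℝ))).indicator 1), integral_indicator_one measurableSet_Iio, h4]
  field_simp

end Polar

/-! ### The degree as an integral over the unit ball -/

section Degree

theorem fderiv_smul_of_homogeneous {V : Type*} [NormedAddCommGroup V] [NormedSpace ℝ V] {F : V → V}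
    (hF : ∀ (s : ℝ) (y : V), 0 < s → F (s • y) = s • F y) {s : ℝ} (hs : 0 < s) (y : V) :
    fderiv ℝ F (s • y) = fderiv ℝ F y := by
  have h1 : fderiv ℝ (fun y => F (s • y)) y = s • fderiv ℝ F (s • y) := by
    rw [fderiv_comp_smul]
  have h2 : fderiv ℝ (fun y => F (s • y)) y = s • fderiv ℝ F y := by
    rw [show (fun y => F (s • y)) = s • F from funext fun y => hF s y hs, fderiv_const_smul_field]
    rfl
  exact smul_right_injective _ hs.ne' (h1.symm.trans h2)

variable {n : ℕ} {Φ : AmbientSpace n → AmbientSpace n}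

theorem contMDiff_of_homogeneous (hs : ∀ y ≠ 0, ContDiffAt ℝ ∞ Φ y)
    {f : UnitSphere n → UnitSphere n} (hf : ∀ x, (f x : AmbientSpace n) = Φ x) :
    ContMDiff (𝓡 n) (𝓡 n) ∞ f := by
  have : Fact (Module.finrank ℝ (AmbientSpace n) = n + 1) := ⟨by simp⟩
  have h1 : ContMDiff (𝓡 n) 𝓘(ℝ, AmbientSpace n) ∞ (fun x : UnitSphere n => Φ x) := by
    intro x
    exact (hs _ (ne_zero_of_mem_unit_sphere x)).contMDiffAt.comp x (contMDiff_coe_sphere x)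
  have h2 : ∀ x : UnitSphere n, Φ x ∈ sphere (0 : AmbientSpace n) 1 := fun x => hf x ▸ (f x).2
  rw [show f = Set.codRestrict _ _ h2 from funext fun x => Subtype.ext (hf x)]
  exact h1.codRestrict_sphere h2

variable (hom : ∀ (s : ℝ) (y : AmbientSpace n), 0 < s → Φ (s • y) = Φ y)
include hom

theorem radialExtension_of_homogeneous {y : AmbientSpace n} (hy : y ≠ 0) :
    radialExtension (fun x : UnitSphere n => Φ x) y = Φ y := by
  rw [radialExtension, dif_neg hy, hom _ _ (inv_pos.2 (norm_pos_iff.2 hy))]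

theorem sphereDeriv_of_homogeneous (x : UnitSphere n) :
    sphereDeriv (fun x : UnitSphere n => Φ x) x = fderiv ℝ Φ x := by
  refine Filter.EventuallyEq.fderiv_eq ?_
  filter_upwards [isOpen_ne.mem_nhds (ne_zero_of_mem_unit_sphere x)] with y hy
  exact radialExtension_of_homogeneous hom hy

/-- At a unit vector `x` the norm has gradient `x`, so the product rule produces exactly the
rank-one term in the definition of the Jacobian. -/
theorem sphereJacobian_of_homogeneous (hd : ∀ y ≠ 0, DifferentiableAt ℝ Φ y)
    {f : UnitSphere n → UnitSphere n} (hf : ∀ x, (f x : AmbientSpace n) = Φ x) (x : UnitSphere n) :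
    sphereJacobian f x = (fderiv ℝ (fun y => ‖y‖ • Φ y) x).det := by
  have hx : ‖(x : AmbientSpace n)‖ = 1 := by simp
  have hx0 := ne_zero_of_mem_unit_sphere x
  have h1 : fderiv ℝ (fun y : AmbientSpace n => ‖y‖) x = innerSL ℝ (x : AmbientSpace n) := by
    have h2 := (hasStrictFDerivAt_norm_sq (x : AmbientSpace n)).hasFDerivAt.sqrt (by simp)
    simp only [Real.sqrt_sq (norm_nonneg _), hx] at h2
    rw [h2.fderiv]
    ext v
    simp
  have h3 : DifferentiableAt ℝ (fun y : AmbientSpace n => ‖y‖) x := differentiableAt_id.norm ℝ hx0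
  rw [sphereJacobian, show (fun z => (f z : AmbientSpace n)) = fun z : UnitSphere n => Φ z from
    funext hf, sphereDeriv_of_homogeneous hom, hf x,
    (h3.hasFDerivAt.fun_smul (hd _ hx0).hasFDerivAt).fderiv, h1, hx, one_smul]

theorem brouwerDegree_of_homogeneous (hd : ∀ y ≠ 0, DifferentiableAt ℝ Φ y)
    {f : UnitSphere n → UnitSphere n} (hf : ∀ x, (f x : AmbientSpace n) = Φ x) :
    brouwerDegree f = (∫ y in ball 0 1, (fderiv ℝ (fun y => ‖y‖ • Φ y) y).det)
      / (volume : Measure (AmbientSpace n)).real (ball 0 1) := by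
  have h1 : ∀ (s : ℝ) (y : AmbientSpace n), 0 < s → ‖s • y‖ • Φ (s • y) = s • (‖y‖ • Φ y) :=
    fun s y hs => by rw [hom s y hs, norm_smul, Real.norm_of_nonneg hs.le, mul_smul]
  have h2 := finrank_mul_setIntegral_ball_of_homogeneous (volume : Measure (AmbientSpace n))
    (g := fun y => (fderiv ℝ (fun y => ‖y‖ • Φ y) y).det)
    fun s y hs => by rw [fderiv_smul_of_homogeneous h1 hs]
  have h3 : (Module.finrank ℝ (AmbientSpace n) : ℝ) ≠ 0 := by simp; positivity
  rw [brouwerDegree, surfaceMeasure, Measure.toSphere_real_apply_univ,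
    integral_congr_ae (.of_forall fun x => sphereJacobian_of_homogeneous hom hd hf x), ← h2,
    mul_div_mul_left _ _ h3]

end Degree

/-! ### Lipschitz constant of the glued map -/

section Lipschitz

variable {V : Type*} [NormedAddCommGroup V] [InnerProductSpace ℝ V] {ι : Type*}
  {e : V} {c : ι → V} {k : ℝ}

/-- With `t = inner ℝ y e`, the triangle inequality gives `1 ≤ t / k + t * ‖c - e‖ + t ≤ 2 * t`. The
caps thus stay away from the equator, where central projection degenerates. -/
theorem half_le_inner_of_mem_bubbleCone {c : V} (he : ‖e‖ = 1) (hk : 0 < k)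
    (hc : ‖c - e‖ + 1 / k ≤ 1) {y : V} (hy : y ∈ bubbleCone e c k) (hy1 : ‖y‖ = 1) :
    1 / 2 ≤ inner ℝ y e := by
  obtain ⟨ht, h⟩ := hy
  have h1 : ‖y‖ ≤ ‖y - inner ℝ y e • c‖ + ‖inner ℝ y e • (c - e)‖ + ‖inner ℝ y e • e‖ := by
    refine le_trans (le_of_eq ?_) (norm_add₃_le)
    congr 1
    module
  rw [norm_smul, norm_smul, Real.norm_of_nonneg ht.le, he, hy1] at h1
  have h2 : ‖y - inner ℝ y e • c‖ < inner ℝ y e * (1 / k) := by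
    rw [mul_one_div, lt_div_iff₀ hk]
    linarith
  nlinarith

theorem norm_coneCoord_sub_le (he : ‖e‖ = 1) (hk : 0 < k) (c : V) {x y : V} (hy : ‖y‖ = 1)
    (hxt : 1 / 4 ≤ inner ℝ x e) (hyt : 1 / 4 ≤ inner ℝ y e) :
    ‖coneCoord e c k x - coneCoord e c k y‖ ≤ 20 * k * ‖x - y‖ := by
  set t := inner ℝ x e with ht
  set s := inner ℝ y e with hs
  have hts : |s - t| ≤ ‖x - y‖ := by
    rw [ht, hs, ← inner_sub_left, norm_sub_rev]
    simpa [he] using abs_real_inner_le_norm (y - x) e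
  have h1 : coneCoord e c k x - coneCoord e c k y
      = k • (t⁻¹ • (x - y) + ((s - t) * (t⁻¹ * s⁻¹)) • y) := by
    have h0 : (s - t) * (t⁻¹ * s⁻¹) = t⁻¹ - s⁻¹ := by field_simp
    rw [h0, coneCoord, coneCoord, ← ht, ← hs]
    module
  have h2 : t⁻¹ ≤ 4 := by rw [inv_le_comm₀ (by linarith) (by norm_num)]; linarith
  have h3 : s⁻¹ ≤ 4 := by rw [inv_le_comm₀ (by linarith) (by norm_num)]; linarith
  have h4 : 0 < t⁻¹ := inv_pos.2 (by linarith)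
  have h5 : 0 < s⁻¹ := inv_pos.2 (by linarith)
  have h6 : t⁻¹ * s⁻¹ ≤ 16 := by nlinarith
  rw [h1, norm_smul, Real.norm_of_nonneg hk.le]
  -- `20 = 4 + 16`, from the bounds on `t⁻¹` and `t⁻¹ * s⁻¹`.
  have h7 : ‖t⁻¹ • (x - y) + ((s - t) * (t⁻¹ * s⁻¹)) • y‖ ≤ 20 * ‖x - y‖ := by
    refine (norm_add_le _ _).trans ?_
    rw [norm_smul, norm_smul, hy, Real.norm_of_nonneg h4.le, norm_mul,
      Real.norm_of_nonneg (mul_pos h4 h5).le, Real.norm_eq_abs]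
    have := mul_le_mul hts h6 (mul_pos h4 h5).le (norm_nonneg _)
    nlinarith [norm_nonneg (x - y)]
  nlinarith

variable [Fintype ι]

theorem norm_multiBubble_sub_le (he : ‖e‖ = 1) (hc : ∀ i, inner ℝ (c i) e = 1) (hk : 1 ≤ k)
    (hsep : Pairwise fun i j => 2 ≤ k * ‖c i - c j‖) (hce : ∀ i, ‖c i - e‖ + 1 / k ≤ 1)
    {K : NNReal} (hK : LipschitzWith K (bubble e)) {x y : V} (hx : ‖x‖ = 1) (hy : ‖y‖ = 1) :
    ‖multiBubble e c k x - multiBubble e c k y‖ ≤ (40 * K + 8) * k * ‖x - y‖ := by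
  have hk0 : 0 < k := by linarith
  have hK0 : (0 : ℝ) ≤ K := K.2
  have hzero : ∀ {i : ι} {w : V}, 1 / 4 ≤ inner ℝ w e → w ∉ bubbleCone e (c i) k →
      bubble e (coneCoord e (c i) k w) = 0 := by
    intro i w hw hwi
    refine bubble_eq_zero e ?_
    by_contra hcon
    exact hwi ((mem_bubbleCone_iff hk0).2 ⟨by linarith, not_le.1 hcon⟩)
  have key : ∀ {x y : V}, ‖x‖ = 1 → ‖y‖ = 1 → ∀ i, x ∈ bubbleCone e (c i) k →
      ‖multiBubble e c k x - multiBubble e c k y‖ ≤ (40 * K + 8) * k * ‖x - y‖ := by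
    intro x y hx hy i hxi
    have hxt := half_le_inner_of_mem_bubbleCone he hk0 (hce i) hxi hx
    rcases lt_or_ge (inner ℝ y e) (1 / 4) with hyt | hyt
    -- The heights of `x` and `y` differ by at least `1 / 4`, while the values differ by at most
    -- `2`. This is the source of the `8`.
    · have h1 : 1 / 4 ≤ ‖x - y‖ := by
        have h2 : inner ℝ (x - y) e ≤ ‖x - y‖ := by
          simpa [he] using real_inner_le_norm (x - y) e
        rw [inner_sub_left] at h2
        linarith
      have h3 : ‖multiBubble e c k x - multiBubble e c k y‖ ≤ 2 := by
        refine (norm_sub_le _ _).trans ?_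
        rw [norm_multiBubble he hc hk0 hsep, norm_multiBubble he hc hk0 hsep]
        norm_num
      have h4 : 8 ≤ (40 * K + 8) * k := by nlinarith
      nlinarith
    · have hlip : ∀ j, ‖bubble e (coneCoord e (c j) k x) - bubble e (coneCoord e (c j) k y)‖
          ≤ 20 * K * k * ‖x - y‖ := fun j => by
        have h1 := hK.norm_sub_le (coneCoord e (c j) k x) (coneCoord e (c j) k y)
        have h2 := norm_coneCoord_sub_le he hk0 (c j) (x := x) hy (by linarith) hyt
        nlinarith
      have hfin : 40 * K * k * ‖x - y‖ ≤ (40 * K + 8) * k * ‖x - y‖ := by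
        gcongr
        linarith
      have hnn : 0 ≤ 20 * K * k * ‖x - y‖ := by positivity
      by_cases h : ∃ j, y ∈ bubbleCone e (c j) k
      · obtain ⟨j, hyj⟩ := h
        rw [multiBubble_of_mem hk0 hsep hxi, multiBubble_of_mem hk0 hsep hyj, sub_sub_sub_cancel_right]
        rcases eq_or_ne i j with rfl | hij
        · linarith [hlip i]
        -- Each bubble vanishes at the other point, so the difference splits into two increments of
        -- single bubbles. Hence `40 = 2 * 20`, whatever the number of bubbles.
        · have h1 := hzero hyt fun hyi =>
            (disjoint_bubbleCone hk0 hsep hij).le_bot ⟨hyi, hyj⟩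
          have h2 := hzero (by linarith) fun hxj =>
            (disjoint_bubbleCone hk0 hsep hij).le_bot ⟨hxi, hxj⟩
          have h3 := norm_add_le
            (bubble e (coneCoord e (c i) k x) - bubble e (coneCoord e (c i) k y))
            (bubble e (coneCoord e (c j) k x) - bubble e (coneCoord e (c j) k y))
          have h4 := hlip i
          have h5 := hlip j
          rw [h1, h2, sub_zero, zero_sub] at h3
          rw [h1, sub_zero] at h4
          rw [h2, zero_sub] at h5
          rw [sub_eq_add_neg]
          linarith
      · push Not at h
        have h4 := hlip i
        rw [hzero hyt (h i)] at h4
        rw [multiBubble_of_mem hk0 hsep hxi, multiBubble_of_forall_notMem hk0 h]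
        rw [show bubble e (coneCoord e (c i) k x) - e - -e
          = bubble e (coneCoord e (c i) k x) - 0 by abel]
        linarith
  by_cases h : ∃ i, x ∈ bubbleCone e (c i) k
  · obtain ⟨i, hi⟩ := h
    exact key hx hy i hi
  · by_cases h' : ∃ i, y ∈ bubbleCone e (c i) k
    · obtain ⟨i, hi⟩ := h'
      rw [norm_sub_rev, norm_sub_rev x y]
      exact key hy hx i hi
    · push Not at h h'
      rw [multiBubble_of_forall_notMem hk0 h, multiBubble_of_forall_notMem hk0 h', sub_self,
        norm_zero]
      positivity

end Lipschitz

/-! ### Packing the caps and realizing every degree -/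

section Existence

/-- Centres of `N` disjoint balls of radius at least a constant times `N ^ (-1 / n)`. -/
theorem exists_separated_centers {n : ℕ} (hn : 1 ≤ n) {N : ℕ} (hN : 1 ≤ N) :
    ∃ (c : Fin N → AmbientSpace n) (k : ℝ),
      (∀ i, inner ℝ (c i) (EuclideanSpace.single 0 1 : AmbientSpace n) = 1) ∧
      (Pairwise fun i j => 2 ≤ k * ‖c i - c j‖) ∧
      (∀ i, ‖c i - EuclideanSpace.single 0 1‖ + 1 / k ≤ 1) ∧
      1 ≤ k ∧ k ≤ 8 * n * (N : ℝ) ^ (1 / n : ℝ) := by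
  have hn0 : (1 : ℝ) ≤ n := by exact_mod_cast hn
  have hNr : (1 : ℝ) ≤ (N : ℝ) ^ (1 / n : ℝ) :=
    Real.one_le_rpow (by exact_mod_cast hN) (by positivity)
  set m := ⌈(N : ℝ) ^ (1 / n : ℝ)⌉₊ with hm
  have hm1 : (N : ℝ) ^ (1 / n : ℝ) ≤ m := Nat.le_ceil _
  have hm2 : (m : ℝ) ≤ 2 * (N : ℝ) ^ (1 / n : ℝ) := by
    have := Nat.ceil_lt_add_one (zero_le_one.trans hNr)
    rw [← hm] at this
    linarith
  have hm0 : (1 : ℝ) ≤ m := hNr.trans hm1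
  have hcard : N ≤ m ^ n := by
    have h1 : ((N : ℝ) ^ (1 / n : ℝ)) ^ n ≤ (m : ℝ) ^ n := by gcongr
    rw [one_div, Real.rpow_inv_natCast_pow (by positivity) (by omega)] at h1
    exact_mod_cast h1
  obtain ⟨φ⟩ : Nonempty (Fin N ↪ (Fin n → Fin m)) :=
    Function.Embedding.nonempty_of_card_le (by simpa using hcard)
  -- A grid of `m ^ n ≥ N` points with spacing `1 / (2 * n * m)`, which is `2 / k` for `k = 4 * n *
  -- m`. Each of the `n` coordinates contributes at most `1 / (2 * n)`, so centres lie within `1 /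
  -- 2` of `e`.
  set c : Fin N → AmbientSpace n := fun i => EuclideanSpace.single 0 1 +
    ∑ j : Fin n, ((φ i j : ℝ) / (2 * n * m)) • EuclideanSpace.single j.succ 1 with hc
  have hsucc : ∀ i j, c i (Fin.succ j) = (φ i j : ℝ) / (2 * n * m) := by
    intro i j
    simp [hc, Finset.sum_apply, Pi.single_apply, Fin.succ_inj]
  refine ⟨c, 4 * n * m, fun i => ?_, fun i j hij => ?_, fun i => ?_, ?_, ?_⟩
  · rw [EuclideanSpace.inner_single_right]
    simp [hc, Finset.sum_apply]
  · obtain ⟨l, hl⟩ : ∃ l, φ i l ≠ φ j l := by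
      by_contra hcon
      push Not at hcon
      exact hij (φ.injective (funext hcon))
    have h1 : ‖(c i - c j) l.succ‖ ≤ ‖c i - c j‖ := PiLp.norm_apply_le _ _
    have h2 : (c i - c j) l.succ = ((φ i l : ℝ) - φ j l) / (2 * n * m) := by
      rw [PiLp.sub_apply, hsucc, hsucc, sub_div]
    have h3 : (1 : ℝ) ≤ |(φ i l : ℝ) - φ j l| := by
      have h4 : ((φ i l : ℕ) : ℤ) - (φ j l : ℕ) ≠ 0 := by
        intro h
        exact hl (Fin.ext (by omega))
      exact_mod_cast Int.one_le_abs h4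
    rw [h2, norm_div, Real.norm_eq_abs, Real.norm_of_nonneg (by positivity),
      div_le_iff₀ (by positivity)] at h1
    linarith
  · have h1 : ‖c i - EuclideanSpace.single 0 1‖ ≤ 1 / 2 := by
      rw [hc, add_sub_cancel_left]
      refine (norm_sum_le _ _).trans ?_
      calc ∑ j : Fin n, ‖((φ i j : ℝ) / (2 * n * m)) • (EuclideanSpace.single j.succ 1 : AmbientSpace n)‖
          ≤ ∑ j : Fin n, 1 / (2 * n : ℝ) := by
            refine Finset.sum_le_sum fun j _ => ?_
            rw [norm_smul, PiLp.norm_single, norm_one, mul_one,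
              Real.norm_of_nonneg (by positivity), div_le_div_iff₀ (by positivity) (by positivity)]
            have : ((φ i j : ℕ) : ℝ) ≤ m := by exact_mod_cast (φ i j).2.le
            nlinarith
        _ = 1 / 2 := by
          rw [Finset.sum_const, Finset.card_univ, Fintype.card_fin, nsmul_eq_mul]
          field_simp
    have h2 : 1 / (4 * n * m : ℝ) ≤ 1 / 2 := by
      rw [div_le_div_iff₀ (by positivity) (by norm_num)]
      nlinarith
    linarith
  · nlinarith
  · nlinarith

variable {n : ℕ} {Φ : AmbientSpace n → AmbientSpace n}

theorem brouwerDegree_isometry_comp (hom : ∀ (s : ℝ) (y : AmbientSpace n), 0 < s → Φ (s • y) = Φ y)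
    (hd : ∀ y ≠ 0, DifferentiableAt ℝ Φ y) (ρ : AmbientSpace n ≃ₗᵢ[ℝ] AmbientSpace n)
    {f : UnitSphere n → UnitSphere n} (hf : ∀ x, (f x : AmbientSpace n) = ρ (Φ x)) :
    brouwerDegree f = LinearMap.det (ρ.toLinearEquiv : AmbientSpace n →ₗ[ℝ] AmbientSpace n) *
      ((∫ y in ball 0 1, (fderiv ℝ (fun y => ‖y‖ • Φ y) y).det)
        / (volume : Measure (AmbientSpace n)).real (ball 0 1)) := by
  rw [brouwerDegree_of_homogeneous (Φ := fun y => ρ (Φ y)) (fun s y hs => by rw [hom s y hs])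
    (fun y hy => ρ.differentiable.differentiableAt.comp y (hd y hy)) hf, ← mul_div_assoc,
    ← integral_const_mul]
  congr 2
  funext y
  have h1 : (fun y => ‖y‖ • ρ (Φ y)) = ρ ∘ fun y => ‖y‖ • Φ y := by
    funext y
    simp
  rw [h1, ρ.comp_fderiv]
  exact LinearMap.det_comp _ _

/-- For every degree `d` there is a smooth self-map of the sphere with that degree and with Lipschitz
constant at most a constant times `|d| ^ (1 / n)`. -/
theorem exists_lipschitz_map_of_degree (hn : 1 ≤ n) :
    ∃ C : ℝ, 0 < C ∧ ∀ d : ℤ, ∃ f : UnitSphere n → UnitSphere n,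
      ContMDiff (𝓡 n) (𝓡 n) ∞ f ∧ brouwerDegree f = d ∧
      ∀ x y, ‖(f x : AmbientSpace n) - f y‖
        ≤ C * |(d : ℝ)| ^ (1 / n : ℝ) * ‖(x : AmbientSpace n) - y‖ := by
  set e : AmbientSpace n := EuclideanSpace.single 0 1 with he_def
  have he : ‖e‖ = 1 := by simp [he_def]
  have hdim : 2 ≤ Module.finrank ℝ (AmbientSpace n) := by simp; omega
  obtain ⟨K, hK⟩ := exists_lipschitzWith_bubble e
  have main : ∀ (N : ℕ) (c : Fin N → AmbientSpace n) (k : ℝ), (∀ i, inner ℝ (c i) e = 1) →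
      (Pairwise fun i j => 2 ≤ k * ‖c i - c j‖) → 0 < k → ∀ d : ℤ, d.natAbs = N →
      ∃ f : UnitSphere n → UnitSphere n, ContMDiff (𝓡 n) (𝓡 n) ∞ f ∧ brouwerDegree f = d ∧
        ∀ x y, ‖(f x : AmbientSpace n) - f y‖
          = ‖multiBubble e c k (x : AmbientSpace n) - multiBubble e c k y‖ := by
    intro N c k hc hsep hk d hd
    -- For negative `d` the target is reflected in the hyperplane orthogonal to `e`, with
    -- determinant `-1`. Distances are unaffected.
    obtain ⟨ρ, hρ⟩ : ∃ ρ : AmbientSpace n ≃ₗᵢ[ℝ] AmbientSpace n,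
        LinearMap.det (ρ.toLinearEquiv : AmbientSpace n →ₗ[ℝ] AmbientSpace n) * N = d := by
      rcases d.natAbs_eq with h | h
      · refine ⟨LinearIsometryEquiv.refl ℝ _, ?_⟩
        rw [h, hd]
        simp
      · refine ⟨(Submodule.span ℝ {e})ᗮ.reflection, ?_⟩
        rw [h, hd, Submodule.det_reflection, Submodule.orthogonal_orthogonal,
          finrank_span_singleton (by rintro h; simp [h] at he)]
        simp
    have hval : ∀ x : UnitSphere n, ρ (multiBubble e c k x) ∈ sphere (0 : AmbientSpace n) 1 := by
      intro x
      simp [norm_multiBubble he hc hk hsep]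
    have hsmooth : ∀ y ≠ 0, ContDiffAt ℝ ∞ (multiBubble e c k) y := fun y hy =>
      contDiffAt_multiBubble hk hy
    refine ⟨fun x => ⟨_, hval x⟩, ?_, ?_, fun x y => ?_⟩
    · exact contMDiff_of_homogeneous (Φ := fun y => ρ (multiBubble e c k y))
        (fun y hy => ρ.contDiff.contDiffAt.comp y (hsmooth y hy)) fun x => rfl
    · rw [brouwerDegree_isometry_comp (fun s y hs => multiBubble_smul hs y)
        (fun y hy => (hsmooth y hy).differentiableAt (by simp)) ρ fun x => rfl,
        integral_det_multiBubble volume he hc hk hsep hdim, Fintype.card_fin, mul_div_cancel_right₀,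
        hρ]
      exact (ENNReal.toReal_pos (measure_ball_pos _ _ one_pos).ne' measure_ball_lt_top.ne).ne'
    · rw [← map_sub, ρ.norm_map]
  have hn0 : (1 : ℝ) ≤ n := by exact_mod_cast hn
  refine ⟨(40 * K + 8) * (8 * n), by positivity, fun d => ?_⟩
  rcases Nat.eq_zero_or_pos d.natAbs with h0 | hpos
  -- For `d = 0` the required Lipschitz constant is `0`; the empty family of bubbles gives a
  -- constant map.
  · obtain ⟨f, hf1, hf2, hf3⟩ := main 0 Fin.elim0 1 (fun i => i.elim0) (fun i => i.elim0)
      one_pos d h0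
    refine ⟨f, hf1, hf2, fun x y => ?_⟩
    rw [hf3, multiBubble_of_forall_notMem one_pos (fun i => i.elim0),
      multiBubble_of_forall_notMem one_pos (fun i => i.elim0), sub_self, norm_zero]
    positivity
  · obtain ⟨c, k, hc, hsep, hce, hk, hkN⟩ := exists_separated_centers hn hpos
    obtain ⟨f, hf1, hf2, hf3⟩ := main _ c k hc hsep (by linarith) d rfl
    refine ⟨f, hf1, hf2, fun x y => ?_⟩
    rw [hf3]
    refine (norm_multiBubble_sub_le he hc hk hsep hce hK (by simp) (by simp)).trans ?_
    refine mul_le_mul_of_nonneg_right ?_ (norm_nonneg _)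
    rw [Nat.cast_natAbs, Int.cast_abs] at hkN
    calc (40 * K + 8) * k ≤ (40 * K + 8) * (8 * n * |(d : ℝ)| ^ (1 / n : ℝ)) := by gcongr
      _ = _ := by ring

end Existence

/-! ### Energy of Lipschitz maps at the critical exponent -/

section Energy

open scoped Pointwise in
-- The surface measure of a cap is `n + 1` times the volume of the cone over it. For `r ≤ 1` that
-- cone is covered by about `1 / r` balls of radius `2 * r` centred along the axis; for `r > 1` the
-- total mass suffices.
theorem surfaceMeasure_closedBall_le (n : ℕ) : ∃ A : ℝ, 0 ≤ A ∧ ∀ (x : UnitSphere n) (r : ℝ), 0 < r →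
    surfaceMeasure n (closedBall x r) ≤ ENNReal.ofReal (A * r ^ (n : ℝ)) := by
  set b := (volume : Measure (AmbientSpace n)).real (ball 0 1) with hb
  have hb' : volume (ball (0 : AmbientSpace n) 1) = ENNReal.ofReal b := by
    rw [hb, ofReal_measureReal measure_ball_lt_top.ne]
  have hb0 : 0 ≤ b := measureReal_nonneg
  have hdim : Module.finrank ℝ (AmbientSpace n) = n + 1 := by simp
  refine ⟨(n + 1) * 2 ^ (n + 2) * b, by positivity, fun x r hr => ?_⟩
  rw [Real.rpow_natCast]
  rcases le_or_gt r 1 with hr1 | hr1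
  · have hcov : Set.Ioo (0 : ℝ) 1 • ((↑) '' closedBall x r : Set (AmbientSpace n)) ⊆
        ⋃ j ∈ Finset.range (⌊1 / r⌋₊ + 1), closedBall ((j * r) • (x : AmbientSpace n)) (2 * r) := by
      rintro _ ⟨t, ⟨ht0, ht1⟩, _, ⟨y, hy, rfl⟩, rfl⟩
      have htr : 0 ≤ t / r := by positivity
      simp only [Set.mem_iUnion]
      refine ⟨⌊t / r⌋₊, ?_, ?_⟩
      · rw [Finset.mem_range, Nat.lt_succ_iff]
        exact Nat.floor_le_floor (by gcongr)
      · have h1 := Nat.floor_le htr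
        have h2 := Nat.lt_floor_add_one (t / r)
        rw [le_div_iff₀ hr] at h1
        rw [div_lt_iff₀ hr] at h2
        have h3 : ‖(y : AmbientSpace n) - x‖ ≤ r := by
          rw [← dist_eq_norm]; exact hy
        rw [mem_closedBall, dist_eq_norm]
        calc ‖t • (y : AmbientSpace n) - (⌊t / r⌋₊ * r) • (x : AmbientSpace n)‖
            = ‖t • ((y : AmbientSpace n) - x) + (t - ⌊t / r⌋₊ * r) • (x : AmbientSpace n)‖ := by
              congr 1; module
          _ ≤ t * ‖(y : AmbientSpace n) - x‖ + (t - ⌊t / r⌋₊ * r) * 1 := by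
              refine (norm_add_le _ _).trans (le_of_eq ?_)
              rw [norm_smul, norm_smul, Real.norm_of_nonneg ht0.le,
                Real.norm_of_nonneg (sub_nonneg.2 h1), norm_eq_of_mem_sphere]
          _ ≤ 2 * r := by nlinarith [norm_nonneg ((y : AmbientSpace n) - x)]
    have hball : ∀ v : AmbientSpace n,
        volume (closedBall v (2 * r)) = ENNReal.ofReal ((2 * r) ^ (n + 1) * b) := fun v => by
      rw [Measure.addHaar_closedBall _ _ (by positivity), hdim, hb',
        ← ENNReal.ofReal_mul (by positivity)]
    have hcount : ((⌊1 / r⌋₊ + 1 : ℕ) : ℝ) * r ≤ 2 := by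
      have h1 := Nat.floor_le (show 0 ≤ 1 / r by positivity)
      rw [le_div_iff₀ hr] at h1
      push_cast
      linarith
    rw [surfaceMeasure, Measure.toSphere_apply' _ isClosed_closedBall.measurableSet]
    calc (Module.finrank ℝ (AmbientSpace n) : ℝ≥0∞) *
          volume (Set.Ioo (0 : ℝ) 1 • ((↑) '' closedBall x r : Set (AmbientSpace n)))
        ≤ (Module.finrank ℝ (AmbientSpace n) : ℝ≥0∞) * ∑ j ∈ Finset.range (⌊1 / r⌋₊ + 1),
            volume (closedBall (((j : ℝ) * r) • (x : AmbientSpace n)) (2 * r)) := by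
          gcongr
          exact (measure_mono hcov).trans (measure_biUnion_finset_le _ _)
      _ = ENNReal.ofReal ((n + 1) * (((⌊1 / r⌋₊ + 1 : ℕ) : ℝ) * ((2 * r) ^ (n + 1) * b))) := by
          simp only [hball, Finset.sum_const, Finset.card_range, hdim, nsmul_eq_mul]
          rw [← Nat.cast_add_one, ENNReal.ofReal_mul (Nat.cast_nonneg (n + 1)),
            ENNReal.ofReal_natCast, ENNReal.ofReal_mul (Nat.cast_nonneg (⌊1 / r⌋₊ + 1)),
            ENNReal.ofReal_natCast]
      _ ≤ ENNReal.ofReal ((n + 1) * 2 ^ (n + 2) * b * r ^ n) := by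
          refine ENNReal.ofReal_le_ofReal ?_
          calc (n + 1) * (((⌊1 / r⌋₊ + 1 : ℕ) : ℝ) * ((2 * r) ^ (n + 1) * b))
              = (n + 1) * (2 ^ (n + 1) * r ^ n * b) * (((⌊1 / r⌋₊ + 1 : ℕ) : ℝ) * r) := by ring
            _ ≤ (n + 1) * (2 ^ (n + 1) * r ^ n * b) * 2 := by gcongr
            _ = _ := by ring
  · refine (measure_mono (Set.subset_univ _)).trans ?_
    rw [surfaceMeasure, Measure.toSphere_apply_univ, hdim, hb', ← ENNReal.ofReal_natCast,
      ← ENNReal.ofReal_mul (by positivity)]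
    refine ENNReal.ofReal_le_ofReal ?_
    push_cast
    have h1 : (1 : ℝ) ≤ 2 ^ (n + 2) * r ^ n :=
      one_le_mul_of_one_le_of_one_le (one_le_pow₀ (by norm_num)) (one_le_pow₀ hr1.le)
    calc ((n : ℝ) + 1) * b = (n + 1) * b * 1 := by ring
      _ ≤ (n + 1) * b * (2 ^ (n + 2) * r ^ n) := by gcongr
      _ = _ := by ring

variable {X : Type*} [PseudoMetricSpace X] [MeasurableSpace X] [OpensMeasurableSpace X]

/-- Summing a geometric sequence of bounds on balls. -/
theorem lintegral_le_of_geometric (σ : Measure X) {x : X} {S : Set X} (hS : MeasurableSet S)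
    {g : X → ℝ≥0∞} {a r : ℕ → ℝ} {M q : ℝ} (hM : 0 ≤ M) (hq0 : 0 ≤ q) (hq1 : q < 1)
    (hcov : ∀ y ∈ S, g y ≠ 0 → ∃ j, y ∈ closedBall x (r j) ∧ g y ≤ ENNReal.ofReal (a j))
    (hmass : ∀ j, ENNReal.ofReal (a j) * σ (closedBall x (r j)) ≤ ENNReal.ofReal (M * q ^ j)) :
    ∫⁻ y in S, g y ∂σ ≤ ENNReal.ofReal (M * (1 - q)⁻¹) := by
  calc ∫⁻ y in S, g y ∂σ
      ≤ ∫⁻ y in S, ∑' j, (closedBall x (r j)).indicator (fun _ => ENNReal.ofReal (a j)) y ∂σ := by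
        refine setLIntegral_mono' hS fun y hy => ?_
        rcases eq_or_ne (g y) 0 with h0 | h0
        · simp [h0]
        · obtain ⟨j, hj, hle⟩ := hcov y hy h0
          refine le_trans ?_ (ENNReal.le_tsum j)
          rwa [Set.indicator_of_mem hj]
    _ ≤ ∫⁻ y, ∑' j, (closedBall x (r j)).indicator (fun _ => ENNReal.ofReal (a j)) y ∂σ :=
        setLIntegral_le_lintegral _ _
    _ = ∑' j, ENNReal.ofReal (a j) * σ (closedBall x (r j)) := by
        rw [lintegral_tsum fun j => (measurable_const.indicator
          isClosed_closedBall.measurableSet).aemeasurable]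
        congr 1
        funext j
        rw [lintegral_indicator_const isClosed_closedBall.measurableSet]
    _ ≤ ∑' j, ENNReal.ofReal (M * q ^ j) := ENNReal.tsum_le_tsum hmass
    _ = ENNReal.ofReal (M * (1 - q)⁻¹) := by
        rw [← ENNReal.ofReal_tsum_of_nonneg (fun j => by positivity)
          ((summable_geometric_of_lt_one hq0 hq1).mul_left M), tsum_mul_left,
          tsum_geometric_of_lt_one hq0 hq1]

/-- The inner integral of the Gagliardo energy of a bounded `L`-Lipschitz function on an
upper Ahlfors regular space, at the critical exponent. -/
theorem exists_lintegral_gagliardo_le {σ : Measure X} {A ν p : ℝ} (hA : 0 ≤ A) (hν : 0 < ν)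
    (hp : ν < p) (hσ : ∀ (x : X) (r : ℝ), 0 < r → σ (closedBall x r) ≤ ENNReal.ofReal (A * r ^ ν)) :
    ∃ C : ℝ, 0 ≤ C ∧ ∀ (L : ℝ) (x : X) (D : X → ℝ), 0 < L → (∀ y, 0 ≤ D y) → (∀ y, D y ≤ 2) →
      (∀ y, D y ≤ L * dist x y) →
      ∫⁻ y, ENNReal.ofReal (D y ^ p / dist x y ^ (ν + ν)) ∂σ ≤ ENNReal.ofReal (C * L ^ ν) := by
  have hp0 : 0 < p := hν.trans hp
  -- Ratios of the dyadic sums: `q₁` for distances below `1 / L`, where `ν < p` is needed, and `q₂`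
  -- for distances above.
  set q₁ : ℝ := (1 / 2) ^ (p - ν) with hq₁
  set q₂ : ℝ := (1 / 2) ^ ν with hq₂
  have hq₁1 : q₁ < 1 := Real.rpow_lt_one (by norm_num) (by norm_num) (by linarith)
  have hq₂1 : q₂ < 1 := Real.rpow_lt_one (by norm_num) (by norm_num) hν
  have hq₁0 : 0 < q₁ := by positivity
  have hq₂0 : 0 < q₂ := by positivity
  have hs₁ : 0 < (1 - q₁)⁻¹ := inv_pos.2 (by linarith)
  have hs₂ : 0 < (1 - q₂)⁻¹ := inv_pos.2 (by linarith)
  refine ⟨2 ^ (ν + ν) * A * (1 - q₁)⁻¹ + 2 ^ p * 2 ^ ν * A * (1 - q₂)⁻¹, by positivity,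
    fun L x D hL hD0 hD2 hDL => ?_⟩
  have hmeas : MeasurableSet {y | L * dist x y ≤ 1} :=
    (isClosed_le (by fun_prop) continuous_const).measurableSet
  -- Division by zero gives `0` on the diagonal, so the dyadic shells need not reach distance `0`.
  have hdist : ∀ y, ENNReal.ofReal (D y ^ p / dist x y ^ (ν + ν)) ≠ 0 → 0 < dist x y := by
    intro y hy
    refine dist_nonneg.lt_of_ne fun h => hy ?_
    rw [← h, Real.zero_rpow (by positivity), div_zero, ENNReal.ofReal_zero]
  have hnear : ∫⁻ y in {y | L * dist x y ≤ 1}, ENNReal.ofReal (D y ^ p / dist x y ^ (ν + ν)) ∂σ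
      ≤ ENNReal.ofReal ((2 ^ (ν + ν) * A * L ^ ν) * (1 - q₁)⁻¹) := by
    refine lintegral_le_of_geometric σ (x := x) hmeas (by positivity) hq₁0.le hq₁1
      (a := fun j => ((1 / 2 : ℝ) ^ j) ^ p / ((1 / 2 : ℝ) ^ j / (2 * L)) ^ (ν + ν))
      (r := fun j => (1 / 2 : ℝ) ^ j / L) (fun y hy h0 => ?_) fun j => ?_
    · have hd := hdist y h0
      obtain ⟨j, hj1, hj2⟩ := exists_nat_pow_near_of_lt_one (mul_pos hL hd) hy
        (show (0 : ℝ) < 1 / 2 by norm_num) (by norm_num)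
      refine ⟨j, ?_, ENNReal.ofReal_le_ofReal ?_⟩
      · rw [mem_closedBall, dist_comm, le_div_iff₀ hL]
        linarith
      · have h1 : (1 / 2 : ℝ) ^ j / (2 * L) ≤ dist x y := by
          rw [div_le_iff₀ (by positivity)]
          rw [pow_succ] at hj1
          linarith
        have h2 : D y ≤ (1 / 2 : ℝ) ^ j := (hDL y).trans hj2
        have h3 := hD0 y
        gcongr
    · set w : ℝ := (1 / 2 : ℝ) ^ j with hw
      have hw0 : 0 < w := by positivity
      refine (mul_le_mul_right (hσ x (w / L) (by positivity)) _).trans ?_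
      rw [← ENNReal.ofReal_mul (by positivity)]
      refine ENNReal.ofReal_le_ofReal (le_of_eq ?_)
      rw [hq₁, Real.rpow_pow_comm (by norm_num), ← hw, Real.rpow_sub hw0,
        Real.div_rpow hw0.le (by positivity), Real.div_rpow hw0.le hL.le,
        Real.mul_rpow (by norm_num) hL.le, Real.rpow_add hw0, Real.rpow_add hL]
      field_simp
  have hfar : ∫⁻ y in {y | L * dist x y ≤ 1}ᶜ, ENNReal.ofReal (D y ^ p / dist x y ^ (ν + ν)) ∂σ
      ≤ ENNReal.ofReal ((2 ^ p * 2 ^ ν * A * L ^ ν) * (1 - q₂)⁻¹) := by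
    refine lintegral_le_of_geometric σ (x := x) hmeas.compl (by positivity) hq₂0.le hq₂1
      (a := fun j => 2 ^ p / ((2 : ℝ) ^ j / L) ^ (ν + ν))
      (r := fun j => 2 * (2 : ℝ) ^ j / L) (fun y hy h0 => ?_) fun j => ?_
    · have hy' : 1 < L * dist x y := not_le.1 hy
      obtain ⟨j, hj1, hj2⟩ := exists_nat_pow_near hy'.le (show (1 : ℝ) < 2 by norm_num)
      refine ⟨j, ?_, ENNReal.ofReal_le_ofReal ?_⟩
      · rw [mem_closedBall, dist_comm, le_div_iff₀ hL]
        rw [pow_succ] at hj2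
        linarith
      · have h1 : (2 : ℝ) ^ j / L ≤ dist x y := by
          rw [div_le_iff₀ hL]
          linarith
        have h2 := hD2 y
        have h3 := hD0 y
        gcongr
    · set v : ℝ := (2 : ℝ) ^ j with hv
      have hv0 : 0 < v := by positivity
      refine (mul_le_mul_right (hσ x (2 * v / L) (by positivity)) _).trans ?_
      rw [← ENNReal.ofReal_mul (by positivity)]
      refine ENNReal.ofReal_le_ofReal (le_of_eq ?_)
      rw [hq₂, Real.rpow_pow_comm (by norm_num), one_div, inv_pow, ← hv, Real.inv_rpow hv0.le,
        Real.div_rpow hv0.le hL.le, Real.div_rpow (by positivity) hL.le,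
        Real.mul_rpow (by norm_num) hv0.le, Real.rpow_add hv0, Real.rpow_add hL]
      field_simp
  rw [← lintegral_add_compl _ hmeas]
  refine (add_le_add hnear hfar).trans ?_
  rw [← ENNReal.ofReal_add (by positivity) (by positivity)]
  exact ENNReal.ofReal_le_ofReal (le_of_eq (by ring))

variable {n : ℕ}

/-- The factor `2` bounds the radial projection: `‖y‖⁻¹ • y` is within `|1 - ‖y‖| ≤ ‖x - y‖` of `y`.
-/
theorem norm_sphereDeriv_le {u : UnitSphere n → AmbientSpace n} {L : ℝ} (hL : 0 ≤ L)
    (hu : ∀ x y, ‖u x - u y‖ ≤ L * ‖(x : AmbientSpace n) - y‖) (x : UnitSphere n) :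
    ‖sphereDeriv u x‖ ≤ 2 * L := by
  refine norm_fderiv_le_of_lip' ℝ (by positivity) ?_
  have hx0 := ne_zero_of_mem_unit_sphere x
  have hx : ‖(x : AmbientSpace n)‖ = 1 := by simp
  filter_upwards [isOpen_ne.mem_nhds hx0] with y hy
  have hy0 : 0 < ‖y‖ := norm_pos_iff.2 hy
  rw [radialExtension, radialExtension, dif_neg hy, dif_neg hx0]
  refine (hu _ _).trans ?_
  simp only [hx, inv_one, one_smul]
  have h1 : ‖‖y‖⁻¹ • y - y‖ = |‖(x : AmbientSpace n)‖ - ‖y‖| := by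
    have h2 : ‖y‖⁻¹ • y - y = (1 - ‖y‖) • (‖y‖⁻¹ • y) := by
      rw [sub_smul, one_smul, smul_smul, mul_inv_cancel₀ hy0.ne', one_smul]
    rw [h2, norm_smul, norm_smul, norm_inv, norm_norm, inv_mul_cancel₀ hy0.ne', mul_one, hx,
      Real.norm_eq_abs]
  have h3 := norm_sub_le_norm_sub_add_norm_sub (‖y‖⁻¹ • y) y (x : AmbientSpace n)
  have h4 := abs_norm_sub_norm_le (x : AmbientSpace n) y
  rw [norm_sub_rev] at h4
  rw [h1] at h3
  nlinarith

theorem exists_sobolevSeminorm_rpow_le (hn : 1 ≤ n) {s : ℝ} (hs : 0 < s) (hs' : s ≤ 1) :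
    ∃ C : ℝ, 0 ≤ C ∧ ∀ (L : ℝ) (f : UnitSphere n → UnitSphere n), 0 ≤ L →
      (∀ x y, ‖(f x : AmbientSpace n) - f y‖ ≤ L * ‖(x : AmbientSpace n) - y‖) →
      sobolevSeminorm s ((n : ℝ) / s) (fun x => (f x : AmbientSpace n)) ^ ((n : ℝ) / s)
        ≤ ENNReal.ofReal (C * L ^ (n : ℝ)) := by
  have hn0 : (0 : ℝ) < n := by exact_mod_cast hn
  have hp0 : 0 < (n : ℝ) / s := by positivity
  have hfin : IsFiniteMeasure (surfaceMeasure n) := by unfold surfaceMeasure; infer_instance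
  set m := (surfaceMeasure n).real Set.univ with hm
  have hm' : surfaceMeasure n Set.univ = ENNReal.ofReal m := by simp [hm]
  have hm0 : 0 ≤ m := measureReal_nonneg
  have hroot : ∀ I : ℝ≥0∞, (I ^ (1 / ((n : ℝ) / s))) ^ ((n : ℝ) / s) = I := fun I => by
    rw [← ENNReal.rpow_mul, one_div_mul_cancel hp0.ne', ENNReal.rpow_one]
  rcases hs'.eq_or_lt with rfl | hs1
  · refine ⟨2 ^ (n : ℝ) * m, by positivity, fun L f hL hf => ?_⟩
    rw [sobolevSeminorm, if_pos rfl, dirichletSeminorm, hroot, div_one]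
    calc ∫⁻ x, ENNReal.ofReal (‖sphereDeriv (fun x => (f x : AmbientSpace n)) x‖ ^ (n : ℝ))
          ∂(surfaceMeasure n)
        ≤ ∫⁻ _, ENNReal.ofReal ((2 * L) ^ (n : ℝ)) ∂(surfaceMeasure n) := by
          refine lintegral_mono fun x => ENNReal.ofReal_le_ofReal ?_
          have := norm_sphereDeriv_le hL hf x
          gcongr
      _ = ENNReal.ofReal (2 ^ (n : ℝ) * m * L ^ (n : ℝ)) := by
          rw [lintegral_const, hm', ← ENNReal.ofReal_mul (by positivity),
            Real.mul_rpow (by norm_num) hL]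
          congr 1
          ring
  · obtain ⟨A, hA, hball⟩ := surfaceMeasure_closedBall_le n
    obtain ⟨C, hC, hG⟩ := exists_lintegral_gagliardo_le hA hn0
      (show (n : ℝ) < (n : ℝ) / s by rw [lt_div_iff₀ hs]; nlinarith) hball
    refine ⟨C * m, by positivity, fun L f hL hf => ?_⟩
    -- The kernel exponent `n + s * (n / s)` becomes `n + n`, twice the dimension in the ball
    -- estimate.
    rw [sobolevSeminorm, if_neg hs1.ne, gagliardoSeminorm, hroot, mul_div_cancel₀ _ hs.ne']
    rcases hL.eq_or_lt with rfl | hL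
    · have h0 : ∀ x y, ‖(f x : AmbientSpace n) - f y‖ = 0 := fun x y =>
        le_antisymm (by simpa using hf x y) (norm_nonneg _)
      simp [h0, Real.zero_rpow hp0.ne']
    · calc _ ≤ ∫⁻ _, ENNReal.ofReal (C * L ^ (n : ℝ)) ∂(surfaceMeasure n) := by
            refine lintegral_mono fun x => ?_
            refine hG L x (fun y => ‖(f x : AmbientSpace n) - f y‖) hL (fun y => norm_nonneg _)
              (fun y => ?_) fun y => hf x y
            refine (norm_sub_le _ _).trans (le_of_eq ?_)
            rw [norm_eq_of_mem_sphere, norm_eq_of_mem_sphere]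
            norm_num
        _ = ENNReal.ofReal (C * m * L ^ (n : ℝ)) := by
            rw [lintegral_const, hm', ← ENNReal.ofReal_mul (by positivity)]
            congr 1
            ring

end Energy

theorem proposition2p3 (n : ℕ) (hn : 1 ≤ n) (s : ℝ) (hs : 0 < s) (hs' : s ≤ 1) :
    ∃ C : ℝ, 0 < C ∧ ∀ d : ℤ, ∃ f : UnitSphere n → UnitSphere n,
      ContMDiff (𝓡 n) (𝓡 n) ∞ f ∧
      brouwerDegree f = (d : ℝ) ∧
      sobolevSeminorm s ((n : ℝ) / s) (fun x => (f x : AmbientSpace n)) ^ ((n : ℝ) / s)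
        ≤ ENNReal.ofReal (C * |(d : ℝ)|) := by
  have hn0 : (n : ℝ) ≠ 0 := by positivity
  obtain ⟨C₁, hC₁, hf⟩ := exists_lipschitz_map_of_degree hn
  obtain ⟨C₂, hC₂, hE⟩ := exists_sobolevSeminorm_rpow_le hn hs hs'
  -- `C₂` is only known to be nonnegative; adding `1` makes the constant positive.
  refine ⟨C₂ * C₁ ^ (n : ℝ) + 1, by positivity, fun d => ?_⟩
  obtain ⟨f, hf1, hf2, hf3⟩ := hf d
  refine ⟨f, hf1, hf2, (hE _ f (by positivity) hf3).trans (ENNReal.ofReal_le_ofReal ?_)⟩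
  rw [Real.mul_rpow hC₁.le (by positivity), ← Real.rpow_mul (abs_nonneg _),
    one_div_mul_cancel hn0, Real.rpow_one, ← mul_assoc]
  gcongr
  linarith
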